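/- Let $q,d\in\mathbb N$ and let $\|\cdot\|$ be a norm on $\mathbb R^q$ such that all canonical unit vectors have norm $1$. Consider a random bipartite graph on $q$ agents and $d$ objects in which the edges $i\sim j$ ($1\le i\le q$, $1\le j\le d$) occur independently with probabilities $p_{ij}\in[0,1]$, not all equal to $0$. Let $\deg(j)$ be the number of agents linked to object $j$, let $A=(A_{ij})$ be the random $q\times d$ matrix $A_{ij}=\mathbf 1(i\sim j)/\deg(j)$ (with $0/0:=0$), and let $e_j$ denote the canonical unit vectors of $\mathbb R^d$. Let $\alpha>0$ and $K_1,\dots,K_d>0$, and let $V=(V_1,\dots,V_d)^\top$ be a random vector with nonnegative components, independent of the random graph, such that $\mathbb P(V_j>t)\sim K_jt^{-\alpha}$ as $t\to\infty$ for every $j$. Assume that $V$ is multivariate regularly varying with asymptotically independent components, that is, there is a nonzero Radon measure $\nu$ on $[0,\infty]^d\setminus\{0\}$ with $n\,\mathbb P(n^{-1/\alpha}V\in\cdot)\to\nu$ vaguely on $[0,\infty]^d\setminus\{0\}$ as $n\to\infty$, and $\nu$ has mass only on the coordinate axes. Let $F=AV$ and $\mathbb S_+^{q-1}=\{x\in[0,\infty)^q:\|x\|=1\}$.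 Then $F$ is multivariate regularly varying with index $\alpha$ and has a spectral measure $\overline\rho$, that is, a probability measure on $\mathbb S_+^{q-1}$ such that for every $u>0$ $$\frac{\mathbb P(\|F\|>tu,\ F/\|F\|\in\cdot)}{\mathbb P(\|F\|>t)}\ \xrightarrow{v}\ u^{-\alpha}\,\overline\rho(\cdot),\qquad t\to\infty .$$ Its support satisfies $$\operatorname{supp}(\overline\rho)\subseteq S:=\{\|x\|^{-1}x:\ x\in\{0,1\}^q\setminus\{0\}\},$$ so that $\overline\rho$ is concentrated on at most $2^q-1$ points. Moreover, with $C^S_{ind}=\sum_{j=1}^dK_j\,\mathbb E\|Ae_j\|^\alpha$ and $|b|_H=|\{i: b_i\ne0\}|$, for every $b=(b_1,\dots,b_q)\in S$ $$\overline\rho(\{b\})=(C^S_{ind})^{-1}\left\|\frac{(\mathbf 1(b_1>0),\dots,\mathbf 1(b_q>0))^\top}{|b|_H}\right\|^{\alpha}\sum_{j=1}^dK_j\prod_{i=1}^q p_{ij}^{\mathbf 1(b_i>0)}(1-p_{ij})^{\mathbf 1(b_i=0)} .$$ -/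

import Mathlib

open MeasureTheory ProbabilityTheory Filter Topology Asymptotics
open scoped ENNReal Matrix

namespace InsuranceNetwork

/-- Vague convergence of measures on `E`: convergence of the integrals of all continuous real
functions with compact support. -/
def VagueTendsto {E ι : Type*} [TopologicalSpace E] [MeasurableSpace E]
    (l : Filter ι) (m : ι → Measure E) (m₀ : Measure E) : Prop :=
  ∀ f : E → ℝ, Continuous f → HasCompactSupport f →
    Tendsto (fun n => ∫ x, f x ∂(m n)) l (𝓝 (∫ x, f x ∂m₀))

/-- The punctured compactified orthant `[0,∞]^d \ {0}`, with its subspace topology: its compact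
subsets are the compact subsets of `[0,∞]^d` that do not contain the origin. -/
abbrev PuncturedOrthant (d : ℕ) : Type := {x : Fin d → ℝ≥0∞ // x ≠ 0}

/-- The union of the coordinate axes in `[0,∞]^d \ {0}`. -/
def axes (d : ℕ) : Set (PuncturedOrthant d) :=
  {x | ∃ j, ∀ i, i ≠ j → x.1 i = 0}

/-- The measure `𝐏(X / b ∈ ·)` on the Borel sets of `[0,∞]^d \ {0}`, for a random vector `X` with
nonnegative components. -/
noncomputable def scaledLaw {Ω : Type*} [MeasurableSpace Ω] (P : Measure Ω) {d : ℕ}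
    (X : Ω → Fin d → ℝ) (b : ℝ) : Measure (PuncturedOrthant d) :=
  (P.map (fun ω j => ENNReal.ofReal (X ω j / b))).comap Subtype.val

/-- `ν` is the exponent measure of the (nonnegative) random vector `X` for the normalising
sequence `b`: a nonzero Radon measure on `[0,∞]^d \ {0}` with
`n 𝐏(X / b_n ∈ ·) → ν` vaguely. (On this locally compact, second countable space, a Radon measure
is a Borel measure that is finite on compact sets.) -/
structure IsExponentMeasure {Ω : Type*} [MeasurableSpace Ω] (P : Measure Ω) {d : ℕ}
    (X : Ω → Fin d → ℝ) (b : ℕ → ℝ) (ν : Measure (PuncturedOrthant d)) : Prop where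
  b_tendsto : Tendsto b atTop atTop
  ne_zero : ν ≠ 0
  finite_on_compacts : IsFiniteMeasureOnCompacts ν
  vague : VagueTendsto atTop (fun n : ℕ => (n : ℝ≥0∞) • scaledLaw P X (b n)) ν

/-- The random vector `X`, with tail index `α`, is multivariate regularly varying with
asymptotically independent components: it has an exponent measure for the normalisation
`b_n = n^(1/α)`, and this measure has mass only on the axes. -/
def AsymptoticallyIndependent {Ω : Type*} [MeasurableSpace Ω] (P : Measure Ω) {d : ℕ}
    (X : Ω → Fin d → ℝ) (α : ℝ) : Prop :=
  ∃ ν : Measure (PuncturedOrthant d),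
    IsExponentMeasure P X (fun n : ℕ => (n : ℝ) ^ (1 / α)) ν ∧ ν (axes d)ᶜ = 0

/-- The positive part of the unit sphere of `ℝ^q` with respect to the norm `N`. -/
def posSphere {q : ℕ} (N : Seminorm ℝ (Fin q → ℝ)) : Set (Fin q → ℝ) :=
  {x | (∀ i, 0 ≤ x i) ∧ N x = 1}

/-- The measure `𝐏(N X > s, X / N X ∈ ·)` on the Borel sets of the positive unit sphere. -/
noncomputable def angularLaw {Ω : Type*} [MeasurableSpace Ω] (P : Measure Ω) {q : ℕ}
    (N : Seminorm ℝ (Fin q → ℝ)) (X : Ω → Fin q → ℝ) (s : ℝ) : Measure (posSphere N) :=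
  ((P.restrict {ω | s < N (X ω)}).map (fun ω => (N (X ω))⁻¹ • X ω)).comap Subtype.val

/-- `X` is multivariate regularly varying with index `α` and spectral measure `ρ`: `ρ` is a
probability measure on the positive unit sphere and, for every `u > 0`,
`𝐏(N X > t u, X / N X ∈ ·) / 𝐏(N X > t) → u^(-α) ρ` vaguely as `t → ∞`. -/
structure IsSpectralMeasure {Ω : Type*} [MeasurableSpace Ω] (P : Measure Ω) {q : ℕ}
    (N : Seminorm ℝ (Fin q → ℝ)) (X : Ω → Fin q → ℝ) (α : ℝ) (ρ : Measure (posSphere N)) :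
    Prop where
  index_pos : 0 < α
  isProbabilityMeasure : IsProbabilityMeasure ρ
  vague : ∀ u : ℝ, 0 < u →
    VagueTendsto atTop
      (fun t : ℝ => (P {ω | t < N (X ω)})⁻¹ • angularLaw P N X (t * u))
      (ENNReal.ofReal (u ^ (-α)) • ρ)

/-- The degree of the object `j` in a bipartite graph: the number of agents linked to it. -/
def deg {q d : ℕ} (G : Fin q → Fin d → Bool) (j : Fin d) : ℕ :=
  (Finset.univ.filter fun i => G i j = true).card

/-- The weighted adjacency matrix `A i j = 𝟙(i ∼ j) / deg j` (with `0 / 0 = 0`). -/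
noncomputable def adj {q d : ℕ} (G : Fin q → Fin d → Bool) : Matrix (Fin q) (Fin d) ℝ :=
  Matrix.of fun i j => (if G i j = true then 1 else 0) / (deg G j : ℝ)

/-- The constant `∑ j, K j * 𝐄 ‖A e_j‖^α` of the random bipartite graph `G`. -/
noncomputable def CSInd {Ω : Type*} [MeasurableSpace Ω] (P : Measure Ω) {q d : ℕ}
    (N : Seminorm ℝ (Fin q → ℝ)) (G : Ω → Fin q → Fin d → Bool) (K : Fin d → ℝ) (α : ℝ) : ℝ :=
  ∑ j, K j * ∫ ω, N (adj (G ω) *ᵥ Pi.single j 1) ^ α ∂P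

/-- The set of the normalised points `x / ‖x‖`, `x ∈ {0,1}^q \ {0}`. -/
def cubePoints {q : ℕ} (N : Seminorm ℝ (Fin q → ℝ)) : Set (Fin q → ℝ) :=
  {b | ∃ x : Fin q → ℝ, (∀ i, x i = 0 ∨ x i = 1) ∧ x ≠ 0 ∧ b = (N x)⁻¹ • x}

end InsuranceNetwork

open InsuranceNetwork

/-!
The proof is the principle of the single big jump.

Asymptotic independence means that two different components of `V` exceed a multiple of `t` together
only with probability `o(t ^ (-α))`. This is read off from the exponent measure by testing vague
convergence against a function that vanishes on the axes
(`AsymptoticallyIndependent.tendsto_rpow_mul`). Hence, for a fixed matrix with columns `a j`, the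
vector `∑ j, V j • a j` can be larger than `t` in norm, up to an event of that order, only because a
single `V j` is large, and then its norm and direction are those of `V j • a j` up to a small error.
The deterministic form of this is `abs_angularTest_sum_sub_le`; taking expectations and using the
Pareto tails of the `V j`, one obtains in `tendsto_integral_angularTest_sum`, for bounded
continuous `g`,

  `t ^ α * E[g (X / N X); N X > t] → ∑ j, K j * N (a j) ^ α * g (a j / N (a j))`,
  where `X = ∑ j, V j • a j`.

The random graph takes finitely many values and is independent of `V`, so averaging over it replaces
the right-hand side by its expectation (`tendsto_integral_angularTest_exposure`). The limit is
`CSInd` times the integral of `g` against the probability measure `exposureSpectralMeasure`, which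
mixes the directions of the columns of the adjacency matrix; replacing `t` by `t u` produces the
factor `u ^ (-α)` (`isSpectralMeasure_of_tendsto`). Spectral measures are unique because the positive
unit sphere is compact (`IsSpectralMeasure.eq`), so the remaining assertions concern this explicit
measure only. A column is its support's indicator divided by the degree, hence its direction is a
normalised cube point which determines the set of linked agents and the norm of the column
(`normalize_column_eq_iff`, `column_eq_of_support_eq`); the mass at such a point then follows from
the independence of the edges (`columnMixture_singleton`, `measureReal_column_eq`).
-/

namespace InsuranceNetwork

/-! ### Norms on `ℝ^q` -/

theorem seminorm_continuous {q : ℕ} (N : Seminorm ℝ (Fin q → ℝ)) : Continuous N := by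
  have hle : ∀ x : Fin q → ℝ, N x ≤ ∑ i, |x i| * N (Pi.single i 1) := fun x => by
    have hx : x = ∑ i, x i • (Pi.single i (1 : ℝ) : Fin q → ℝ) := by
      ext k
      simp [Finset.sum_apply, Pi.single_apply]
    calc N x = N (∑ i, x i • (Pi.single i (1 : ℝ) : Fin q → ℝ)) := by rw [← hx]
      _ ≤ ∑ i, N (x i • (Pi.single i (1 : ℝ) : Fin q → ℝ)) :=
        Finset.le_sum_of_subadditive N (map_zero N).le (map_add_le_add N) _ _
      _ = _ := by simp [map_smul_eq_mul]
  refine Seminorm.continuous_of_continuousAt_zero ?_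
  have h0 : Tendsto (fun x : Fin q → ℝ => ∑ i, |x i| * N (Pi.single i 1)) (𝓝 0) (𝓝 0) := by
    have hc : Continuous (fun x : Fin q → ℝ => ∑ i, |x i| * N (Pi.single i 1)) := by fun_prop
    simpa using hc.tendsto 0
  rw [ContinuousAt, map_zero]
  exact squeeze_zero (fun x => apply_nonneg N x) hle h0

theorem exists_mul_norm_le_seminorm {q : ℕ} (N : Seminorm ℝ (Fin q → ℝ))
    (hN : ∀ x, N x = 0 → x = 0) : ∃ c > 0, ∀ x, c * ‖x‖ ≤ N x := by
  rcases (Metric.sphere (0 : Fin q → ℝ) 1).eq_empty_or_nonempty with he | hne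
  · refine ⟨1, one_pos, fun x => ?_⟩
    have hx : x = 0 := by
      by_contra hx
      have : ‖x‖⁻¹ • x ∈ Metric.sphere (0 : Fin q → ℝ) 1 := by
        simp [norm_smul, hx]
      simp [he] at this
    simp [hx]
  · obtain ⟨y, hy, hmin⟩ := (isCompact_sphere (0 : Fin q → ℝ) 1).exists_isMinOn hne
      (seminorm_continuous N).continuousOn
    have hy0 : y ≠ 0 := fun h => by simp [h] at hy
    refine ⟨N y, (apply_nonneg N y).lt_of_ne fun h => hy0 (hN y h.symm), fun x => ?_⟩
    rcases eq_or_ne x 0 with rfl | hx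
    · simp
    have hx' : 0 < ‖x‖ := norm_pos_iff.2 hx
    have h1 : ‖x‖⁻¹ • x ∈ Metric.sphere (0 : Fin q → ℝ) 1 := by simp [norm_smul, hx]
    have h2 := isMinOn_iff.1 hmin _ h1
    rw [map_smul_eq_mul, norm_inv, norm_norm, inv_mul_eq_div, le_div_iff₀ hx'] at h2
    exact h2

theorem isCompact_unitSphere {q : ℕ} (N : Seminorm ℝ (Fin q → ℝ))
    (hN : ∀ x, N x = 0 → x = 0) : IsCompact {x | N x = 1} := by
  obtain ⟨c, hc, h⟩ := exists_mul_norm_le_seminorm N hN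
  refine Metric.isCompact_of_isClosed_isBounded
    (isClosed_eq (seminorm_continuous N) continuous_const) ?_
  refine (Metric.isBounded_closedBall (x := (0 : Fin q → ℝ)) (r := c⁻¹)).subset fun x hx => ?_
  have := h x
  rw [show N x = 1 from hx] at this
  rw [mem_closedBall_zero_iff, inv_eq_one_div, le_div_iff₀ hc]
  linarith

theorem isClosed_posSphere {q : ℕ} (N : Seminorm ℝ (Fin q → ℝ)) : IsClosed (posSphere N) := by
  have h : posSphere N = (⋂ i, {x | 0 ≤ x i}) ∩ {x | N x = 1} := by
    ext x; simp [posSphere]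
  rw [h]
  exact (isClosed_iInter fun i => isClosed_le continuous_const (continuous_apply i)).inter
    (isClosed_eq (seminorm_continuous N) continuous_const)

theorem isCompact_posSphere {q : ℕ} (N : Seminorm ℝ (Fin q → ℝ))
    (hN : ∀ x, N x = 0 → x = 0) : IsCompact (posSphere N) :=
  (isCompact_unitSphere N hN).of_isClosed_subset (isClosed_posSphere N) fun _ hx => hx.2

/-- A continuous function is uniformly continuous, measured by `N`, on the unit sphere of `N`. -/
theorem exists_modulus_on_unitSphere {q : ℕ} (N : Seminorm ℝ (Fin q → ℝ))
    (hN : ∀ x, N x = 0 → x = 0) {g : (Fin q → ℝ) → ℝ} (hg : Continuous g) {ε : ℝ} (hε : 0 < ε) :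
    ∃ δ > 0, ∀ x y, N x = 1 → N y = 1 → N (x - y) ≤ δ → |g x - g y| ≤ ε := by
  obtain ⟨c, hc, h⟩ := exists_mul_norm_le_seminorm N hN
  obtain ⟨δ, hδ, hu⟩ := Metric.uniformContinuousOn_iff.1
    ((isCompact_unitSphere N hN).uniformContinuousOn_of_continuous hg.continuousOn) ε hε
  refine ⟨c * δ / 2, by positivity, fun x y hx hy hxy => (hu x hx y hy ?_).le⟩
  have := (h (x - y)).trans hxy
  rw [dist_eq_norm]
  nlinarith [mul_pos hc hδ]

/-! ### The single big jump: a pointwise comparison -/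

/-- The functional `x ↦ 𝟙(N x > t) g(x / N x)`. Its expectation at a random vector is the integral
of `g` against the angular law of the vector beyond the level `t`. -/
noncomputable def angularTest {q : ℕ} (N : Seminorm ℝ (Fin q → ℝ)) (g : (Fin q → ℝ) → ℝ) (t : ℝ)
    (x : Fin q → ℝ) : ℝ :=
  if t < N x then g ((N x)⁻¹ • x) else 0

theorem abs_angularTest_le {q : ℕ} (N : Seminorm ℝ (Fin q → ℝ)) {g : (Fin q → ℝ) → ℝ} {M : ℝ}
    (hM : ∀ x, |g x| ≤ M) (t : ℝ) (x : Fin q → ℝ) : |angularTest N g t x| ≤ M := by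
  unfold angularTest
  split_ifs
  · exact hM _
  · simpa using (abs_nonneg _).trans (hM 0)

theorem angularTest_eq_zero {q : ℕ} {N : Seminorm ℝ (Fin q → ℝ)} {g : (Fin q → ℝ) → ℝ} {t : ℝ}
    {x : Fin q → ℝ} (h : N x ≤ t) : angularTest N g t x = 0 :=
  if_neg h.not_gt

/-- Normalisation is Lipschitz away from the origin. -/
theorem seminorm_normalize_sub_le {q : ℕ} (N : Seminorm ℝ (Fin q → ℝ)) {x y : Fin q → ℝ}
    (hx : 0 < N x) (hy : 0 < N y) :
    N ((N x)⁻¹ • x - (N y)⁻¹ • y) ≤ 2 * N (x - y) / N x := by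
  have h1 : (N x)⁻¹ • x - (N y)⁻¹ • y = (N x)⁻¹ • (x - y) + ((N x)⁻¹ - (N y)⁻¹) • y := by
    module
  have h2 : |N x - N y| ≤ N (x - y) := abs_sub_map_le_sub N x y
  have h3 : |(N x)⁻¹ - (N y)⁻¹| * N y = |N x - N y| / N x := by
    have : (N x)⁻¹ - (N y)⁻¹ = -(N x - N y) / (N x * N y) := by field_simp; ring
    rw [this, abs_div, abs_neg, abs_of_pos (mul_pos hx hy)]
    field_simp
  rw [h1]
  refine (map_add_le_add N _ _).trans ?_
  rw [map_smul_eq_mul, map_smul_eq_mul, Real.norm_eq_abs, Real.norm_eq_abs, h3,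
    abs_of_pos (inv_pos.2 hx), two_mul, add_div, inv_mul_eq_div]
  gcongr

/-- If `x` is within `κ t` of `y`, the functional `angularTest` at level `t` takes nearly the same
values at `x` and `y`, unless `N y` lies in the window `((1 - κ) t, (1 + κ) t]`. -/
theorem abs_angularTest_sub_le {q : ℕ} (N : Seminorm ℝ (Fin q → ℝ)) {g : (Fin q → ℝ) → ℝ}
    {M ε κ t : ℝ} (hM : ∀ x, |g x| ≤ M) (hκ : 0 < κ) (ht : 0 < t) (hε : 0 ≤ ε)
    (hmod : ∀ x y, N x = 1 → N y = 1 → N (x - y) ≤ 2 * κ → |g x - g y| ≤ ε)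
    {x y : Fin q → ℝ} (hxy : N (x - y) ≤ κ * t) :
    |angularTest N g t x - angularTest N g t y| ≤
      ε * (if t < N y then 1 else 0) +
        2 * M * ((if (1 - κ) * t < N y then 1 else 0) - (if (1 + κ) * t < N y then 1 else 0)) := by
  have hM0 : 0 ≤ M := (abs_nonneg _).trans (hM 0)
  have hκt := mul_pos hκ ht
  have hN := abs_le.1 ((abs_sub_map_le_sub N x y).trans hxy)
  rcases le_or_gt (N y) ((1 - κ) * t) with h1 | h1
  · have hy : N y ≤ t := by linarith
    have hy' : N y ≤ (1 + κ) * t := by linarith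
    rw [angularTest_eq_zero (x := x) (by linarith), angularTest_eq_zero hy]
    simp [h1.not_gt, hy.not_gt, hy'.not_gt]
  rcases le_or_gt (N y) ((1 + κ) * t) with h2 | h2
  · rw [if_pos h1, if_neg h2.not_gt]
    have hb : |angularTest N g t x - angularTest N g t y| ≤ M + M :=
      (abs_sub _ _).trans (add_le_add (abs_angularTest_le N hM t x) (abs_angularTest_le N hM t y))
    have : 0 ≤ ε * (if t < N y then 1 else 0) := by positivity
    linarith
  · have hy : t < N y := by linarith
    have hx : t < N x := by linarith
    rw [if_pos hy, if_pos h1, if_pos h2, angularTest, angularTest, if_pos hx, if_pos hy]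
    have hx0 := ht.trans hx
    have hy0 := ht.trans hy
    simp only [mul_one, sub_self, mul_zero, add_zero]
    refine hmod _ _ ?_ ?_ ((seminorm_normalize_sub_le N hx0 hy0).trans ?_)
    · rw [map_smul_eq_mul, norm_inv, Real.norm_of_nonneg hx0.le, inv_mul_cancel₀ hx0.ne']
    · rw [map_smul_eq_mul, norm_inv, Real.norm_of_nonneg hy0.le, inv_mul_cancel₀ hy0.ne']
    · rw [div_le_iff₀ hx0]
      nlinarith

/-- The single big jump principle, pointwise: if no two of the coefficients `v j` exceed a small
multiple of `t`, the functional `angularTest` of the combination `∑ j, v j • a j` is close to the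
sum of its values at the individual summands. -/
theorem abs_angularTest_sum_sub_le {q d : ℕ} (N : Seminorm ℝ (Fin q → ℝ))
    {g : (Fin q → ℝ) → ℝ} {M ε κ C t : ℝ} (hM : ∀ x, |g x| ≤ M) (hκ : 0 < κ) (hκ1 : κ < 1)
    (ht : 0 < t) (hε : 0 ≤ ε)
    (hmod : ∀ x y, N x = 1 → N y = 1 → N (x - y) ≤ 2 * κ → |g x - g y| ≤ ε)
    {a : Fin d → Fin q → ℝ} (hC : 0 < C) (haC : ∑ j, N (a j) ≤ C)
    {v : Fin d → ℝ} (hv : ∀ j, 0 ≤ v j) :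
    |angularTest N g t (∑ j, v j • a j) - ∑ j, angularTest N g t (v j • a j)| ≤
      (d + 1) * M * (∑ j, ∑ k, if j ≠ k ∧ κ / C * t < v j ∧ κ / C * t < v k then 1 else 0) +
      ∑ j, (ε * (if t < N (a j) * v j then 1 else 0) +
        2 * M * ((if (1 - κ) * t < N (a j) * v j then 1 else 0)
          - (if (1 + κ) * t < N (a j) * v j then 1 else 0))) := by
  have hM0 : 0 ≤ M := (abs_nonneg _).trans (hM 0)
  have hNv : ∀ j, N (v j • a j) = N (a j) * v j := fun j => by
    rw [map_smul_eq_mul, Real.norm_of_nonneg (hv j), mul_comm]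
  have hterm : ∀ j, 0 ≤ ε * (if t < N (a j) * v j then 1 else 0) +
        2 * M * ((if (1 - κ) * t < N (a j) * v j then 1 else 0)
          - (if (1 + κ) * t < N (a j) * v j then 1 else 0)) := fun j => by
    have h1 : 0 ≤ ε * (if t < N (a j) * v j then 1 else 0) := by positivity
    have h2 : (0 : ℝ) ≤ (if (1 - κ) * t < N (a j) * v j then 1 else 0)
          - (if (1 + κ) * t < N (a j) * v j then 1 else 0) := by
      have := mul_pos hκ ht
      split_ifs
      · simp
      · simp
      · linarith
      · simp
    have := mul_nonneg (mul_nonneg zero_le_two hM0) h2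
    linarith
  by_cases hpair : ∃ j k, j ≠ k ∧ κ / C * t < v j ∧ κ / C * t < v k
  · obtain ⟨j, k, hjk⟩ := hpair
    have hS : (1 : ℝ) ≤ ∑ j, ∑ k, if j ≠ k ∧ κ / C * t < v j ∧ κ / C * t < v k then 1 else 0 := by
      have h0 : ∀ j k, (0 : ℝ) ≤ if j ≠ k ∧ κ / C * t < v j ∧ κ / C * t < v k then 1 else 0 :=
        fun j k => by positivity
      calc (1 : ℝ) = if j ≠ k ∧ κ / C * t < v j ∧ κ / C * t < v k then 1 else 0 :=
            (if_pos hjk).symm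
        _ ≤ ∑ k, if j ≠ k ∧ κ / C * t < v j ∧ κ / C * t < v k then 1 else 0 :=
            Finset.single_le_sum (fun k _ => h0 j k) (Finset.mem_univ k)
        _ ≤ _ := Finset.single_le_sum
            (f := fun j => ∑ k, if j ≠ k ∧ κ / C * t < v j ∧ κ / C * t < v k then (1 : ℝ) else 0)
            (fun j _ => Finset.sum_nonneg fun k _ => h0 j k) (Finset.mem_univ j)
    have hL : |angularTest N g t (∑ j, v j • a j) - ∑ j, angularTest N g t (v j • a j)|
        ≤ (d + 1) * M := by
      refine (abs_sub _ _).trans ?_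
      have h1 := abs_angularTest_le N hM t (∑ j, v j • a j)
      have h2 : |∑ j, angularTest N g t (v j • a j)| ≤ d * M := by
        refine (Finset.abs_sum_le_sum_abs _ _).trans ?_
        refine (Finset.sum_le_sum fun j _ => abs_angularTest_le N hM t (v j • a j)).trans ?_
        simp
      linarith
    have hD : 0 ≤ (d + 1) * M := by positivity
    have := Finset.sum_nonneg fun j (_ : j ∈ Finset.univ) => hterm j
    nlinarith
  · push Not at hpair
    have hη : 0 < κ / C * t := by positivity
    have haj : ∀ j, N (a j) ≤ C := fun j =>
      (Finset.single_le_sum (f := fun j => N (a j)) (fun j _ => apply_nonneg N _)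
        (Finset.mem_univ j)).trans haC
    have hsmall : ∀ k, v k ≤ κ / C * t → N (v k • a k) ≤ t := fun k hk => by
      rw [hNv]
      calc N (a k) * v k ≤ C * (κ / C * t) := mul_le_mul (haj k) hk (hv k) hC.le
        _ = κ * t := by field_simp
        _ ≤ t := by nlinarith
    have hsub : ∀ s : Finset (Fin d), (∀ k ∈ s, v k ≤ κ / C * t) →
        N (∑ k ∈ s, v k • a k) ≤ κ * t := fun s hs => by
      calc N (∑ k ∈ s, v k • a k) ≤ ∑ k ∈ s, N (v k • a k) :=
            Finset.le_sum_of_subadditive N (map_zero N).le (map_add_le_add N) _ _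
        _ ≤ ∑ k ∈ s, N (a k) * (κ / C * t) := Finset.sum_le_sum fun k hk => by
            rw [hNv]; exact mul_le_mul_of_nonneg_left (hs k hk) (apply_nonneg N _)
        _ = (∑ k ∈ s, N (a k)) * (κ / C * t) := by rw [Finset.sum_mul]
        _ ≤ C * (κ / C * t) := by
            refine mul_le_mul_of_nonneg_right (le_trans ?_ haC) hη.le
            exact Finset.sum_le_sum_of_subset_of_nonneg (Finset.subset_univ s)
              fun k _ _ => apply_nonneg N _
        _ = κ * t := by field_simp
    have hS : (0 : ℝ) ≤ (d + 1) * M *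
        ∑ j, ∑ k, if j ≠ k ∧ κ / C * t < v j ∧ κ / C * t < v k then 1 else 0 := by positivity
    by_cases hj : ∃ j, κ / C * t < v j
    · obtain ⟨j, hj⟩ := hj
      have hothers : ∀ k, k ≠ j → v k ≤ κ / C * t := fun k hk => hpair j k hk.symm hj
      have hsum : ∑ k, angularTest N g t (v k • a k) = angularTest N g t (v j • a j) :=
        Finset.sum_eq_single j
          (fun k _ hk => angularTest_eq_zero (hsmall k (hothers k hk))) (by simp)
      have hdiff : N (∑ k, v k • a k - v j • a j) ≤ κ * t := by
        rw [← Finset.add_sum_erase _ _ (Finset.mem_univ j), add_sub_cancel_left]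
        exact hsub _ fun k hk => hothers k (Finset.ne_of_mem_erase hk)
      have hb := abs_angularTest_sub_le N hM hκ ht hε hmod hdiff
      rw [hNv] at hb
      have := Finset.single_le_sum (fun j _ => hterm j) (Finset.mem_univ j)
      rw [hsum]
      linarith
    · push Not at hj
      rw [angularTest_eq_zero ((hsub _ fun k _ => hj k).trans (by nlinarith)),
        Finset.sum_eq_zero fun k _ => angularTest_eq_zero (hsmall k (hj k))]
      have := Finset.sum_nonneg fun j (_ : j ∈ Finset.univ) => hterm j
      simp only [sub_self, abs_zero]
      linarith

/-! ### Marginal and joint tails -/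

theorem tendsto_rpow_mul_tail {Ω : Type*} [MeasurableSpace Ω] {P : Measure Ω} {α k : ℝ}
    (hα : 0 < α) {X : Ω → ℝ}
    (h : (fun t : ℝ => P.real {ω | t < X ω}) ~[atTop] fun t => k * t ^ (-α))
    {w c : ℝ} (hw : 0 ≤ w) (hc : 0 < c) :
    Tendsto (fun t : ℝ => t ^ α * P.real {ω | c * t < w * X ω}) atTop
      (𝓝 (k * (w / c) ^ α)) := by
  have h1 : Tendsto (fun t : ℝ => t ^ α * P.real {ω | t < X ω}) atTop (𝓝 k) := by
    have h2 : (fun t : ℝ => t ^ α * P.real {ω | t < X ω}) ~[atTop]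
        fun t : ℝ => t ^ α * (k * t ^ (-α)) := IsEquivalent.refl.mul h
    refine h2.symm.tendsto_nhds ?_
    refine tendsto_const_nhds.congr' ?_
    filter_upwards [eventually_gt_atTop 0] with t ht
    rw [Real.rpow_neg ht.le]
    have := (Real.rpow_pos_of_pos ht α).ne'
    field_simp
  rcases hw.eq_or_lt with rfl | hw
  · simp only [zero_mul, zero_div, Real.zero_rpow hα.ne', mul_zero]
    refine tendsto_const_nhds.congr' ?_
    filter_upwards [eventually_gt_atTop 0] with t ht
    have : ¬ c * t < 0 := by have := mul_pos hc ht; linarith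
    simp [this]
  · have h3 : Tendsto (fun t : ℝ => c / w * t) atTop atTop :=
      tendsto_id.const_mul_atTop (by positivity)
    have h4 := (h1.comp h3).mul_const ((w / c) ^ α)
    refine h4.congr' ?_
    filter_upwards [eventually_gt_atTop 0] with t ht
    have hset : {ω | c / w * t < X ω} = {ω | c * t < w * X ω} := by
      ext ω
      simp only [Set.mem_ofPred_eq]
      rw [div_mul_eq_mul_div, div_lt_iff₀ hw, mul_comm (X ω)]
    simp only [Function.comp_apply]
    rw [hset, Real.mul_rpow (by positivity) ht.le, Real.div_rpow hc.le hw.le,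
      Real.div_rpow hw.le hc.le]
    have := (Real.rpow_pos_of_pos hc α).ne'
    have := (Real.rpow_pos_of_pos hw α).ne'
    field_simp

/-- The test function `max 0 (min (x j) (x k) ∧ ε - ε / 2)` on `[0,∞]^d`: it vanishes on the
coordinate axes and near the origin, and equals `ε / 2` where both coordinates are at least `ε`. -/
noncomputable def pairTest {d : ℕ} (j k : Fin d) (ε : ℝ) (x : Fin d → ℝ≥0∞) : ℝ :=
  max 0 ((min (min (x j) (x k)) (ENNReal.ofReal ε)).toReal - ε / 2)

theorem continuous_pairTest {d : ℕ} (j k : Fin d) (ε : ℝ) : Continuous (pairTest j k ε) := by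
  unfold pairTest
  refine continuous_const.max (Continuous.sub ?_ continuous_const)
  refine ENNReal.continuousOn_toReal.comp_continuous (by fun_prop) fun x => ?_
  exact (lt_of_le_of_lt (min_le_right _ _) ENNReal.ofReal_lt_top).ne

theorem pairTest_eq_zero {d : ℕ} {j k : Fin d} {ε : ℝ} (hε : 0 < ε) {x : Fin d → ℝ≥0∞}
    (h : min (x j) (x k) ≤ ENNReal.ofReal (ε / 2)) : pairTest j k ε x = 0 := by
  unfold pairTest
  refine max_eq_left ?_
  have : (min (min (x j) (x k)) (ENNReal.ofReal ε)).toReal ≤ ε / 2 :=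
    ENNReal.toReal_le_of_le_ofReal (by linarith) ((min_le_left _ _).trans h)
  linarith

theorem hasCompactSupport_pairTest {d : ℕ} {j k : Fin d} {ε : ℝ} (hε : 0 < ε) :
    HasCompactSupport (fun x : PuncturedOrthant d => pairTest j k ε x.1) := by
  set S : Set (Fin d → ℝ≥0∞) := {x | ENNReal.ofReal (ε / 2) ≤ min (x j) (x k)}
  have hS : IsClosed S := isClosed_le continuous_const (by fun_prop)
  have himg : Subtype.val '' ((Subtype.val : PuncturedOrthant d → _) ⁻¹' S) = S := by
    refine Set.image_preimage_eq_of_subset fun x hx => ⟨⟨x, fun h0 => ?_⟩, rfl⟩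
    have hx' : ENNReal.ofReal (ε / 2) ≤ min (x j) (x k) := hx
    have : 0 < ENNReal.ofReal (ε / 2) := ENNReal.ofReal_pos.2 (by linarith)
    simp only [h0, Pi.zero_apply, min_self] at hx'
    exact (this.trans_le hx').false
  refine HasCompactSupport.intro (K := (Subtype.val : PuncturedOrthant d → _) ⁻¹' S) ?_ ?_
  · rw [Subtype.isCompact_iff, himg]
    exact hS.isCompact
  · intro x hx
    exact pairTest_eq_zero hε (not_le.1 hx).le

theorem integral_scaledLaw {Ω : Type*} [MeasurableSpace Ω] (P : Measure Ω) {d : ℕ}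
    {X : Ω → Fin d → ℝ} (hX : Measurable X) (b : ℝ) {f : (Fin d → ℝ≥0∞) → ℝ} (hf : Continuous f)
    (hf0 : f 0 = 0) :
    ∫ x, f x.1 ∂(scaledLaw P X b) = ∫ ω, f (fun j => ENNReal.ofReal (X ω j / b)) ∂P := by
  have hs : MeasurableSet {x : Fin d → ℝ≥0∞ | x ≠ 0} := (measurableSet_singleton 0).compl
  have hm : Measurable fun (ω : Ω) (j : Fin d) => ENNReal.ofReal (X ω j / b) :=
    measurable_pi_lambda _ fun j => (((measurable_pi_apply j).comp hX).div_const b).ennreal_ofReal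
  rw [scaledLaw]
  refine (integral_subtype_comap hs f).trans ?_
  rw [setIntegral_eq_integral_of_forall_compl_eq_zero, integral_map hm.aemeasurable
    hf.aestronglyMeasurable]
  intro x hx
  rw [not_not.1 hx, hf0]

/-- Asymptotic independence along the normalising sequence: two different components are jointly of
the order `n^(1/α)` with probability `o(1/n)`. -/
theorem AsymptoticallyIndependent.tendsto_natCast_mul {Ω : Type*} [MeasurableSpace Ω]
    {P : Measure Ω} [IsProbabilityMeasure P] {d : ℕ} {X : Ω → Fin d → ℝ} (hX : Measurable X)
    {α : ℝ} (h : AsymptoticallyIndependent P X α) {j k : Fin d} (hjk : j ≠ k) {ε : ℝ}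
    (hε : 0 < ε) :
    Tendsto (fun n : ℕ => (n : ℝ) * P.real {ω | ε * (n : ℝ) ^ (1 / α) < X ω j ∧
      ε * (n : ℝ) ^ (1 / α) < X ω k}) atTop (𝓝 0) := by
  obtain ⟨ν, hν, haxes⟩ := h
  have hlim := hν.vague (fun x => pairTest j k ε x.1)
    ((continuous_pairTest j k ε).comp continuous_subtype_val) (hasCompactSupport_pairTest hε)
  have hzero : ∫ x, pairTest j k ε x.1 ∂ν = 0 := by
    refine integral_eq_zero_of_ae ?_
    filter_upwards [compl_mem_ae_iff.2 haxes] with x hx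
    rw [compl_compl] at hx
    obtain ⟨i, hi⟩ := hx
    refine pairTest_eq_zero hε ?_
    by_cases hij : j = i
    · have : x.1 k = 0 := hi k fun h => hjk (hij.trans h.symm)
      simp [this]
    · simp [hi j hij]
  rw [hzero] at hlim
  have hlim' := hlim.const_mul (2 / ε)
  rw [mul_zero] at hlim'
  refine squeeze_zero' (Eventually.of_forall fun n => by positivity) ?_ hlim'
  filter_upwards [eventually_gt_atTop 0] with n hn
  have hb : 0 < (n : ℝ) ^ (1 / α) := Real.rpow_pos_of_pos (Nat.cast_pos.2 hn) _
  set b := (n : ℝ) ^ (1 / α)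
  have hf0 : pairTest j k ε 0 = 0 := pairTest_eq_zero hε (by simp)
  rw [integral_smul_measure, integral_scaledLaw P hX b (continuous_pairTest j k ε) hf0]
  have hm : Measurable fun (ω : Ω) (j : Fin d) => ENNReal.ofReal (X ω j / b) :=
    measurable_pi_lambda _ fun j => (((measurable_pi_apply j).comp hX).div_const b).ennreal_ofReal
  set A := {ω | ε * b < X ω j ∧ ε * b < X ω k}
  have hA : MeasurableSet A :=
    (measurableSet_lt measurable_const ((measurable_pi_apply j).comp hX)).inter
      (measurableSet_lt measurable_const ((measurable_pi_apply k).comp hX))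
  have hbd : ∀ x : Fin d → ℝ≥0∞, ‖pairTest j k ε x‖ ≤ ε := fun x => by
    have h1 : (min (min (x j) (x k)) (ENNReal.ofReal ε)).toReal ≤ ε :=
      ENNReal.toReal_le_of_le_ofReal hε.le (min_le_right _ _)
    rw [pairTest, Real.norm_of_nonneg (le_max_left _ _)]
    exact max_le hε.le (by linarith)
  have hint : Integrable (fun ω => pairTest j k ε fun j => ENNReal.ofReal (X ω j / b)) P :=
    Integrable.of_bound ((continuous_pairTest j k ε).measurable.comp hm).aestronglyMeasurable ε
      (Eventually.of_forall fun ω => hbd _)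
  have hle : ε / 2 * P.real A ≤ ∫ ω, pairTest j k ε (fun j => ENNReal.ofReal (X ω j / b)) ∂P := by
    have : ∫ ω, A.indicator (fun _ => ε / 2) ω ∂P = ε / 2 * P.real A := by
      rw [integral_indicator_const _ hA, smul_eq_mul, mul_comm]
    rw [← this]
    refine integral_mono ((integrable_const _).indicator hA) hint
      (Set.indicator_le' (fun ω hω => ?_) fun ω _ => le_max_left _ _)
    have h1 : ε ≤ X ω j / b := ((lt_div_iff₀ hb).2 hω.1).le
    have h2 : ε ≤ X ω k / b := ((lt_div_iff₀ hb).2 hω.2).le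
    refine le_max_of_le_right ?_
    beta_reduce
    rw [min_eq_right (le_min (ENNReal.ofReal_le_ofReal h1) (ENNReal.ofReal_le_ofReal h2)),
      ENNReal.toReal_ofReal hε.le]
    linarith
  rw [ENNReal.toReal_natCast, smul_eq_mul]
  have hn' : (0 : ℝ) ≤ n := n.cast_nonneg
  calc (n : ℝ) * P.real A = 2 / ε * (n * (ε / 2 * P.real A)) := by field_simp
    _ ≤ _ := by gcongr

/-- Asymptotic independence along a continuous parameter. -/
theorem AsymptoticallyIndependent.tendsto_rpow_mul {Ω : Type*} [MeasurableSpace Ω]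
    {P : Measure Ω} [IsProbabilityMeasure P] {d : ℕ} {X : Ω → Fin d → ℝ} (hX : Measurable X)
    {α : ℝ} (hα : 0 < α) (h : AsymptoticallyIndependent P X α) {j k : Fin d} (hjk : j ≠ k) {ε : ℝ}
    (hε : 0 < ε) :
    Tendsto (fun t : ℝ => t ^ α * P.real {ω | ε * t < X ω j ∧ ε * t < X ω k}) atTop (𝓝 0) := by
  have hfl : Tendsto (fun t : ℝ => ⌊t ^ α⌋₊) atTop atTop :=
    tendsto_nat_floor_atTop.comp (tendsto_rpow_atTop hα)
  have h2 := ((h.tendsto_natCast_mul hX hjk hε).comp hfl).const_mul 2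
  rw [mul_zero] at h2
  refine squeeze_zero' ?_ ?_ h2
  · filter_upwards [eventually_ge_atTop 0] with t ht
    exact mul_nonneg (Real.rpow_nonneg ht _) measureReal_nonneg
  filter_upwards [eventually_ge_atTop 1] with t ht
  have ht0 : 0 ≤ t := zero_le_one.trans ht
  have h1 : 1 ≤ t ^ α := Real.one_le_rpow ht hα.le
  -- with `n = ⌊t ^ α⌋` one has `n ^ (1 / α) ≤ t` and `t ^ α ≤ 2 n`
  set n := ⌊t ^ α⌋₊
  have hn1 : (1 : ℝ) ≤ n := by exact_mod_cast Nat.one_le_floor_iff _ |>.2 h1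
  have hn2 : t ^ α ≤ 2 * n := by
    have := Nat.lt_floor_add_one (t ^ α)
    linarith
  have hn3 : (n : ℝ) ^ (1 / α) ≤ t := by
    calc (n : ℝ) ^ (1 / α) ≤ (t ^ α) ^ (1 / α) :=
          Real.rpow_le_rpow n.cast_nonneg (Nat.floor_le (by linarith)) (by positivity)
      _ = t := by rw [← Real.rpow_mul ht0, mul_one_div_cancel hα.ne', Real.rpow_one]
  have hle : ε * (n : ℝ) ^ (1 / α) ≤ ε * t := by gcongr
  have hP : P.real {ω | ε * t < X ω j ∧ ε * t < X ω k} ≤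
      P.real {ω | ε * (n : ℝ) ^ (1 / α) < X ω j ∧ ε * (n : ℝ) ^ (1 / α) < X ω k} :=
    measureReal_mono fun ω hω => ⟨hle.trans_lt hω.1, hle.trans_lt hω.2⟩
  simp only [Function.comp_apply]
  rw [← mul_assoc]
  exact mul_le_mul hn2 hP measureReal_nonneg (by positivity)

/-! ### The tail of a fixed linear image -/

theorem measurable_angularTest {q : ℕ} (N : Seminorm ℝ (Fin q → ℝ)) {g : (Fin q → ℝ) → ℝ}
    (hg : Continuous g) (t : ℝ) : Measurable (angularTest N g t) := by
  have hN := (seminorm_continuous N).measurable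
  unfold angularTest
  exact Measurable.ite (measurableSet_lt measurable_const hN)
    (hg.measurable.comp (hN.inv.smul measurable_id)) measurable_const

theorem integrable_angularTest_comp {Ω : Type*} [MeasurableSpace Ω] {P : Measure Ω}
    [IsFiniteMeasure P] {q : ℕ} (N : Seminorm ℝ (Fin q → ℝ)) {g : (Fin q → ℝ) → ℝ}
    (hg : Continuous g) {M : ℝ} (hM : ∀ x, |g x| ≤ M) (t : ℝ) {X : Ω → Fin q → ℝ}
    (hX : Measurable X) : Integrable (fun ω => angularTest N g t (X ω)) P :=
  Integrable.of_bound ((measurable_angularTest N hg t).comp hX).aestronglyMeasurable M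
    (Eventually.of_forall fun ω => abs_angularTest_le N hM t (X ω))

theorem integrable_ite_one {Ω : Type*} [MeasurableSpace Ω] {P : Measure Ω} [IsFiniteMeasure P]
    {p : Ω → Prop} [DecidablePred p] (hp : MeasurableSet {ω | p ω}) :
    Integrable (fun ω => if p ω then (1 : ℝ) else 0) P :=
  Integrable.of_bound (Measurable.ite hp measurable_const measurable_const).aestronglyMeasurable 1
    (Eventually.of_forall fun ω => by split_ifs <;> simp)

theorem integral_ite_one {Ω : Type*} [MeasurableSpace Ω] {P : Measure Ω}
    {p : Ω → Prop} [DecidablePred p] (hp : MeasurableSet {ω | p ω}) :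
    ∫ ω, (if p ω then (1 : ℝ) else 0) ∂P = P.real {ω | p ω} := by
  rw [← integral_indicator_one hp]
  congr 1
  ext ω
  simp [Set.indicator_apply]

/-- The tail of a one-dimensional summand is the rescaled tail of its coefficient. -/
theorem tendsto_integral_angularTest_smul {Ω : Type*} [MeasurableSpace Ω] {P : Measure Ω}
    {q : ℕ} (N : Seminorm ℝ (Fin q → ℝ)) (g : (Fin q → ℝ) → ℝ) {α k : ℝ} (hα : 0 < α)
    {X : Ω → ℝ} (hX : Measurable X) (hX0 : ∀ᵐ ω ∂P, 0 ≤ X ω)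
    (h : (fun t : ℝ => P.real {ω | t < X ω}) ~[atTop] fun t => k * t ^ (-α)) (a : Fin q → ℝ) :
    Tendsto (fun t : ℝ => t ^ α * ∫ ω, angularTest N g t (X ω • a) ∂P) atTop
      (𝓝 (k * (N a ^ α * g ((N a)⁻¹ • a)))) := by
  have h1 := (tendsto_rpow_mul_tail hα h (apply_nonneg N a) one_pos).mul_const
    (g ((N a)⁻¹ • a))
  rw [div_one, mul_assoc] at h1
  refine h1.congr' ?_
  filter_upwards [eventually_gt_atTop 0] with t ht
  have hms : MeasurableSet {ω | 1 * t < N a * X ω} :=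
    measurableSet_lt measurable_const (measurable_const.mul hX)
  rw [mul_assoc, ← integral_ite_one hms, ← integral_mul_const]
  congr 1
  refine integral_congr_ae ?_
  filter_upwards [hX0] with ω hω
  have hN : N (X ω • a) = N a * X ω := by
    rw [map_smul_eq_mul, Real.norm_of_nonneg hω, mul_comm]
  rw [angularTest, hN, one_mul]
  split_ifs with hlt
  · have hne : X ω ≠ 0 := fun h0 => by
      rw [h0, mul_zero] at hlt
      exact lt_asymm ht hlt
    rw [one_mul, mul_inv, smul_smul, mul_assoc, inv_mul_cancel₀ hne, mul_one]
  · simp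

/-- The single big jump principle, integrated: beyond a high level the angular law of
`∑ j, V j • a j` is, up to `o(t ^ (-α))`, the sum of those of the summands. -/
theorem tendsto_integral_angularTest_sum_sub {Ω : Type*} [MeasurableSpace Ω] {P : Measure Ω}
    [IsProbabilityMeasure P] {q d : ℕ} (N : Seminorm ℝ (Fin q → ℝ)) (hN : ∀ x, N x = 0 → x = 0)
    {g : (Fin q → ℝ) → ℝ} (hg : Continuous g) {M : ℝ} (hM : ∀ x, |g x| ≤ M)
    {α : ℝ} (hα : 0 < α) {K : Fin d → ℝ} {V : Ω → Fin d → ℝ} (hV : Measurable V)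
    (hV0 : ∀ j, ∀ᵐ ω ∂P, 0 ≤ V ω j)
    (hPareto : ∀ j, (fun t : ℝ => P.real {ω | t < V ω j}) ~[atTop] fun t => K j * t ^ (-α))
    (hVind : AsymptoticallyIndependent P V α) (a : Fin d → Fin q → ℝ) :
    Tendsto (fun t : ℝ => t ^ α * ∫ ω, (angularTest N g t (∑ j, V ω j • a j)
      - ∑ j, angularTest N g t (V ω j • a j)) ∂P) atTop (𝓝 0) := by
  have hVj : ∀ j, Measurable fun ω => V ω j := fun j => (measurable_pi_apply j).comp hV
  have hM0 : 0 ≤ M := (abs_nonneg _).trans (hM 0)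
  rw [Metric.tendsto_nhds]
  intro r hr
  -- the limit of the error bound is `ε * S + 2 * M * B κ`, with `B κ → 0` as `κ → 0`
  set S : ℝ := ∑ j, K j * (N (a j) / 1) ^ α with hS
  set B : ℝ → ℝ := fun κ =>
    ∑ j, (K j * (N (a j) / (1 - κ)) ^ α - K j * (N (a j) / (1 + κ)) ^ α) with hB
  set ε : ℝ := r / (2 * (|S| + 1)) with hεdef
  have hε : 0 < ε := by positivity
  have hεS : ε * S < r / 2 + r / 8 := by
    have h1 : ε * S ≤ ε * (|S| + 1) :=
      mul_le_mul_of_nonneg_left ((le_abs_self S).trans (by linarith)) hε.le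
    have h2 : ε * (|S| + 1) = r / 2 := by
      rw [hεdef]; field_simp
    linarith
  obtain ⟨δ, hδ, hmod⟩ := exists_modulus_on_unitSphere N hN hg hε
  have hBlim : Tendsto (fun κ => 2 * M * B κ) (𝓝[>] 0) (𝓝 0) := by
    have hc : ContinuousAt (fun κ => 2 * M * B κ) 0 := by
      have h1 : ∀ j, ContinuousAt (fun κ : ℝ => (N (a j) / (1 - κ)) ^ α) 0 := fun j =>
        (ContinuousAt.div continuousAt_const (by fun_prop) (by norm_num)).rpow_const (Or.inr hα.le)
      have h2 : ∀ j, ContinuousAt (fun κ : ℝ => (N (a j) / (1 + κ)) ^ α) 0 := fun j =>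
        (ContinuousAt.div continuousAt_const (by fun_prop) (by norm_num)).rpow_const (Or.inr hα.le)
      have h3 : ContinuousAt B 0 := tendsto_finsetSum _ fun j _ =>
        ((h1 j).const_mul _).sub ((h2 j).const_mul _)
      exact h3.const_mul _
    have := hc.tendsto.mono_left (nhdsWithin_le_nhds (s := Set.Ioi 0))
    simpa [hB] using this
  obtain ⟨κ, hκB, hκ, hκ1⟩ : ∃ κ, 2 * M * B κ < r / 8 ∧ 0 < κ ∧ κ < min 1 (δ / 2) := by
    have h1 := hBlim.eventually (gt_mem_nhds (show (0 : ℝ) < r / 8 by positivity))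
    have h2 : ∀ᶠ κ : ℝ in 𝓝[>] 0, κ ∈ Set.Ioo 0 (min 1 (δ / 2)) :=
      Ioo_mem_nhdsGT (by positivity)
    obtain ⟨κ, hκ⟩ := (h1.and h2).exists
    exact ⟨κ, hκ.1, hκ.2.1, hκ.2.2⟩
  have hκδ : 2 * κ ≤ δ := by have := hκ1.trans_le (min_le_right _ _); linarith
  replace hκ1 := hκ1.trans_le (min_le_left _ _)
  set C : ℝ := ∑ j, N (a j) + 1
  have hC : 0 < C := by
    have := Finset.sum_nonneg fun j (_ : j ∈ Finset.univ) => apply_nonneg N (a j)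
    positivity
  -- the probabilities occurring in the error bound
  set Q : ℝ → Fin d → Fin d → ℝ := fun t j k =>
    P.real {ω | j ≠ k ∧ κ / C * t < V ω j ∧ κ / C * t < V ω k} with hQ
  set T : ℝ → ℝ → Fin d → ℝ := fun c t j => P.real {ω | c * t < N (a j) * V ω j} with hT
  have hmQ : ∀ t j k, MeasurableSet {ω | j ≠ k ∧ κ / C * t < V ω j ∧ κ / C * t < V ω k} :=
    fun t j k => (MeasurableSet.const _).inter
      ((measurableSet_lt measurable_const (hVj j)).inter
        (measurableSet_lt measurable_const (hVj k)))
  have hmT : ∀ c t j, MeasurableSet {ω | c * t < N (a j) * V ω j} := fun c t j =>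
    measurableSet_lt measurable_const ((hVj j).const_mul _)
  have hQlim : ∀ j k, Tendsto (fun t => t ^ α * Q t j k) atTop (𝓝 0) := fun j k => by
    rcases eq_or_ne j k with rfl | hjk
    · simp [hQ]
    · simpa [hQ, hjk] using hVind.tendsto_rpow_mul hV hα hjk (div_pos hκ hC)
  have hTlim : ∀ c > 0, ∀ j, Tendsto (fun t => t ^ α * T c t j) atTop
      (𝓝 (K j * (N (a j) / c) ^ α)) := fun c hc j =>
    tendsto_rpow_mul_tail hα (hPareto j) (apply_nonneg N _) hc
  have hbound : Tendsto (fun t : ℝ => (d + 1) * M * ∑ j, ∑ k, t ^ α * Q t j k +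
      (ε * ∑ j, t ^ α * T 1 t j +
        2 * M * ∑ j, (t ^ α * T (1 - κ) t j - t ^ α * T (1 + κ) t j))) atTop
      (𝓝 ((d + 1) * M * ∑ _j : Fin d, ∑ _k : Fin d, 0 + (ε * S + 2 * M * B κ))) := by
    refine Tendsto.add (Tendsto.const_mul _ ?_) (Tendsto.add (Tendsto.const_mul _ ?_)
      (Tendsto.const_mul _ ?_))
    · exact tendsto_finsetSum _ fun j _ => tendsto_finsetSum _ fun k _ => hQlim j k
    · exact tendsto_finsetSum _ fun j _ => hTlim 1 one_pos j
    · exact tendsto_finsetSum _ fun j _ =>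
        (hTlim (1 - κ) (by linarith) j).sub (hTlim (1 + κ) (by linarith) j)
  have hlt : (d + 1) * M * ∑ _j : Fin d, ∑ _k : Fin d, (0 : ℝ) + (ε * S + 2 * M * B κ) < r := by
    simp only [Finset.sum_const_zero, mul_zero, zero_add]
    linarith
  filter_upwards [hbound.eventually (gt_mem_nhds hlt), eventually_gt_atTop 0] with t hbt ht
  have hae : ∀ᵐ ω ∂P, ∀ j, 0 ≤ V ω j := ae_all_iff.2 hV0
  rw [dist_zero_right, Real.norm_eq_abs, abs_mul, abs_of_nonneg (Real.rpow_nonneg ht.le α)]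
  refine lt_of_le_of_lt ?_ hbt
  have iQ : ∀ j k, Integrable (fun ω =>
      if j ≠ k ∧ κ / C * t < V ω j ∧ κ / C * t < V ω k then (1 : ℝ) else 0) P :=
    fun j k => integrable_ite_one (hmQ t j k)
  have iT : ∀ c j, Integrable (fun ω => if c * t < N (a j) * V ω j then (1 : ℝ) else 0) P :=
    fun c j => integrable_ite_one (hmT c t j)
  have iQ' : Integrable (fun ω => (d + 1) * M * ∑ j, ∑ k,
      if j ≠ k ∧ κ / C * t < V ω j ∧ κ / C * t < V ω k then (1 : ℝ) else 0) P :=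
    (integrable_finsetSum _ fun j _ => integrable_finsetSum _ fun k _ => iQ j k).const_mul _
  have iW : ∀ j, Integrable (fun ω => 2 * M * ((if (1 - κ) * t < N (a j) * V ω j then (1 : ℝ) else 0)
          - (if (1 + κ) * t < N (a j) * V ω j then 1 else 0))) P := fun j =>
    ((iT _ j).sub (iT _ j)).const_mul _
  have iT' : ∀ j, Integrable (fun ω => ε * (if 1 * t < N (a j) * V ω j then (1 : ℝ) else 0) +
        2 * M * ((if (1 - κ) * t < N (a j) * V ω j then 1 else 0)
          - (if (1 + κ) * t < N (a j) * V ω j then 1 else 0))) P := fun j =>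
    ((iT 1 j).const_mul ε).add (iW j)
  have hint : ∫ ω, ((d + 1) * M *
      (∑ j, ∑ k, if j ≠ k ∧ κ / C * t < V ω j ∧ κ / C * t < V ω k then (1 : ℝ) else 0) +
      ∑ j, (ε * (if 1 * t < N (a j) * V ω j then 1 else 0) +
        2 * M * ((if (1 - κ) * t < N (a j) * V ω j then 1 else 0)
          - (if (1 + κ) * t < N (a j) * V ω j then 1 else 0)))) ∂P =
      (d + 1) * M * ∑ j, ∑ k, Q t j k +
        ∑ j, (ε * T 1 t j + 2 * M * (T (1 - κ) t j - T (1 + κ) t j)) := by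
    rw [integral_add iQ' (integrable_finsetSum _ fun j _ => iT' j), integral_const_mul,
      integral_finsetSum _ fun j _ => integrable_finsetSum _ fun k _ => iQ j k,
      integral_finsetSum _ fun j _ => iT' j]
    congr 2
    · refine Finset.sum_congr rfl fun j _ => ?_
      rw [integral_finsetSum _ fun k _ => iQ j k]
      exact Finset.sum_congr rfl fun k _ => integral_ite_one (hmQ t j k)
    · ext j
      rw [integral_add ((iT 1 j).const_mul ε) (iW j),
        integral_const_mul, integral_const_mul, integral_sub (iT _ j) (iT _ j),
        integral_ite_one (hmT _ t j), integral_ite_one (hmT _ t j), integral_ite_one (hmT _ t j)]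
  calc t ^ α * |∫ ω, (angularTest N g t (∑ j, V ω j • a j)
        - ∑ j, angularTest N g t (V ω j • a j)) ∂P|
      ≤ t ^ α * ∫ ω, ((d + 1) * M *
      (∑ j, ∑ k, if j ≠ k ∧ κ / C * t < V ω j ∧ κ / C * t < V ω k then (1 : ℝ) else 0) +
      ∑ j, (ε * (if 1 * t < N (a j) * V ω j then 1 else 0) +
        2 * M * ((if (1 - κ) * t < N (a j) * V ω j then 1 else 0)
          - (if (1 + κ) * t < N (a j) * V ω j then 1 else 0)))) ∂P := by
        refine mul_le_mul_of_nonneg_left ?_ (Real.rpow_nonneg ht.le α)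
        rw [← Real.norm_eq_abs]
        refine norm_integral_le_of_norm_le (Integrable.add iQ'
          (integrable_finsetSum Finset.univ fun j _ => iT' j)) ?_
        filter_upwards [hae] with ω hω
        simp only [one_mul]
        exact abs_angularTest_sum_sub_le N hM hκ hκ1 ht hε.le
          (fun x y hx hy hxy => hmod x y hx hy (hxy.trans hκδ)) hC
          (le_add_of_nonneg_right zero_le_one) hω
    _ = _ := by
        rw [hint]
        simp only [mul_add, Finset.mul_sum, Finset.sum_add_distrib, mul_sub, Finset.sum_sub_distrib]
        congr 1
        · refine Finset.sum_congr rfl fun j _ => Finset.sum_congr rfl fun k _ => by ring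
        · congr 1
          · exact Finset.sum_congr rfl fun j _ => by ring
          · congr 1 <;> exact Finset.sum_congr rfl fun j _ => by ring

/-- The tail of a fixed linear image of the claims: each column of the matrix contributes
separately. -/
theorem tendsto_integral_angularTest_sum {Ω : Type*} [MeasurableSpace Ω] {P : Measure Ω}
    [IsProbabilityMeasure P] {q d : ℕ} (N : Seminorm ℝ (Fin q → ℝ)) (hN : ∀ x, N x = 0 → x = 0)
    {g : (Fin q → ℝ) → ℝ} (hg : Continuous g) {M : ℝ} (hM : ∀ x, |g x| ≤ M)
    {α : ℝ} (hα : 0 < α) {K : Fin d → ℝ} {V : Ω → Fin d → ℝ} (hV : Measurable V)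
    (hV0 : ∀ j, ∀ᵐ ω ∂P, 0 ≤ V ω j)
    (hPareto : ∀ j, (fun t : ℝ => P.real {ω | t < V ω j}) ~[atTop] fun t => K j * t ^ (-α))
    (hVind : AsymptoticallyIndependent P V α) (a : Fin d → Fin q → ℝ) :
    Tendsto (fun t : ℝ => t ^ α * ∫ ω, angularTest N g t (∑ j, V ω j • a j) ∂P) atTop
      (𝓝 (∑ j, K j * (N (a j) ^ α * g ((N (a j))⁻¹ • a j)))) := by
  have hVj : ∀ j, Measurable fun ω => V ω j := fun j => (measurable_pi_apply j).comp hV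
  have h1 := (tendsto_integral_angularTest_sum_sub N hN hg hM hα hV hV0 hPareto hVind a).add
    (tendsto_finsetSum Finset.univ fun j _ =>
      tendsto_integral_angularTest_smul N g hα (hVj j) (hV0 j) (hPareto j) (a j))
  rw [zero_add] at h1
  refine h1.congr fun t => ?_
  have hi : ∀ j, Integrable (fun ω => angularTest N g t (V ω j • a j)) P := fun j =>
    integrable_angularTest_comp N hg hM t ((hVj j).smul_const _)
  rw [integral_sub (integrable_angularTest_comp N hg hM t
      (Finset.measurable_sum _ fun j _ => (hVj j).smul_const _))
    (integrable_finsetSum _ fun j _ => hi j), integral_finsetSum _ fun j _ => hi j,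
    ← Finset.mul_sum]
  ring

/-! ### Averaging over the random graph -/

theorem adj_mulVec_eq_sum {q d : ℕ} (γ : Fin q → Fin d → Bool) (v : Fin d → ℝ) :
    adj γ *ᵥ v = ∑ j, v j • (adj γ *ᵥ Pi.single j 1) := by
  ext i
  simp [Matrix.mulVec, dotProduct, Finset.sum_apply, mul_comm]

/-- The tail of the exposures: since the graph takes finitely many values and is independent of the
claims, the limits for fixed matrices are averaged over the law of the graph. -/
theorem tendsto_integral_angularTest_exposure {Ω : Type*} [MeasurableSpace Ω] {P : Measure Ω}
    [IsProbabilityMeasure P] {q d : ℕ} (N : Seminorm ℝ (Fin q → ℝ)) (hN : ∀ x, N x = 0 → x = 0)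
    {g : (Fin q → ℝ) → ℝ} (hg : Continuous g) {M : ℝ} (hM : ∀ x, |g x| ≤ M)
    {α : ℝ} (hα : 0 < α) {K : Fin d → ℝ} {V : Ω → Fin d → ℝ} (hV : Measurable V)
    (hV0 : ∀ j, ∀ᵐ ω ∂P, 0 ≤ V ω j)
    (hPareto : ∀ j, (fun t : ℝ => P.real {ω | t < V ω j}) ~[atTop] fun t => K j * t ^ (-α))
    (hVind : AsymptoticallyIndependent P V α)
    {G : Ω → Fin q → Fin d → Bool} (hG : Measurable G) (hGV : IndepFun G V P) :
    Tendsto (fun t : ℝ => t ^ α * ∫ ω, angularTest N g t (adj (G ω) *ᵥ V ω) ∂P) atTop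
      (𝓝 (∑ j, K j * ∫ ω, N (adj (G ω) *ᵥ Pi.single j 1) ^ α *
        g ((N (adj (G ω) *ᵥ Pi.single j 1))⁻¹ • (adj (G ω) *ᵥ Pi.single j 1)) ∂P)) := by
  have hPG : IsProbabilityMeasure (P.map G) := Measure.isProbabilityMeasure_map hG.aemeasurable
  have hPV : IsProbabilityMeasure (P.map V) := Measure.isProbabilityMeasure_map hV.aemeasurable
  have hsum : ∀ h : (Fin q → Fin d → Bool) → ℝ,
      ∫ ω, h (G ω) ∂P = ∑ γ, (P.map G).real {γ} * h γ := fun h => by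
    rw [← integral_map hG.aemeasurable (f := h) (measurable_of_finite h).aestronglyMeasurable,
      integral_fintype Integrable.of_finite]
    rfl
  have hlim := tendsto_finsetSum Finset.univ fun γ (_ : γ ∈ Finset.univ) =>
    (tendsto_integral_angularTest_sum N hN hg hM hα hV hV0 hPareto hVind
      fun j => adj γ *ᵥ Pi.single j 1).const_mul ((P.map G).real {γ})
  have hval : ∑ γ, (P.map G).real {γ} * ∑ j, K j * (N (adj γ *ᵥ Pi.single j 1) ^ α *
        g ((N (adj γ *ᵥ Pi.single j 1))⁻¹ • (adj γ *ᵥ Pi.single j 1))) =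
      ∑ j, K j * ∫ ω, N (adj (G ω) *ᵥ Pi.single j 1) ^ α *
        g ((N (adj (G ω) *ᵥ Pi.single j 1))⁻¹ • (adj (G ω) *ᵥ Pi.single j 1)) ∂P := by
    simp_rw [Finset.mul_sum]
    rw [Finset.sum_comm]
    refine Finset.sum_congr rfl fun j _ => ?_
    rw [hsum fun γ => N (adj γ *ᵥ Pi.single j 1) ^ α *
        g ((N (adj γ *ᵥ Pi.single j 1))⁻¹ • (adj γ *ᵥ Pi.single j 1)), Finset.mul_sum]
    exact Finset.sum_congr rfl fun γ _ => by ring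
  rw [hval] at hlim
  refine hlim.congr fun t => ?_
  have hγ : ∀ γ : Fin q → Fin d → Bool,
      Measurable fun v : Fin d → ℝ => angularTest N g t (adj γ *ᵥ v) := fun γ =>
    (measurable_angularTest N hg t).comp
      (continuous_const.matrix_mulVec continuous_id).measurable
  have hmeas : Measurable fun z : (Fin q → Fin d → Bool) × (Fin d → ℝ) =>
      angularTest N g t (adj z.1 *ᵥ z.2) :=
    measurable_from_prod_countable_right hγ
  have hint : ∫ ω, angularTest N g t (adj (G ω) *ᵥ V ω) ∂P =
      ∫ γ, ∫ v, angularTest N g t (adj γ *ᵥ v) ∂(P.map V) ∂(P.map G) := by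
    rw [← integral_prod _ (Integrable.of_bound hmeas.aestronglyMeasurable M
        (Eventually.of_forall fun z => abs_angularTest_le N hM t _)),
      ← (indepFun_iff_map_prod_eq_prod_map_map hG.aemeasurable hV.aemeasurable).1 hGV,
      integral_map (hG.prodMk hV).aemeasurable hmeas.aestronglyMeasurable]
  rw [hint, integral_fintype Integrable.of_finite, Finset.mul_sum]
  refine Finset.sum_congr rfl fun γ _ => ?_
  rw [integral_map hV.aemeasurable (hγ γ).aestronglyMeasurable, smul_eq_mul]
  simp_rw [← adj_mulVec_eq_sum]
  ring

/-! ### The columns of the adjacency matrix -/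

theorem adj_mulVec_single {q d : ℕ} (γ : Fin q → Fin d → Bool) (j : Fin d) :
    adj γ *ᵥ Pi.single j 1 = (deg γ j : ℝ)⁻¹ • fun i => if γ i j = true then (1 : ℝ) else 0 := by
  ext i
  simp [adj, div_eq_inv_mul]

theorem adj_mulVec_nonneg {q d : ℕ} (γ : Fin q → Fin d → Bool) {v : Fin d → ℝ}
    (hv : ∀ j, 0 ≤ v j) (i : Fin q) : 0 ≤ (adj γ *ᵥ v) i := by
  change 0 ≤ ∑ j, adj γ i j * v j
  refine Finset.sum_nonneg fun j _ => mul_nonneg ?_ (hv j)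
  simp only [adj, Matrix.of_apply]
  positivity

theorem adj_mulVec_single_pos_iff {q d : ℕ} (γ : Fin q → Fin d → Bool) (i : Fin q) (j : Fin d) :
    0 < (adj γ *ᵥ Pi.single j 1) i ↔ γ i j = true := by
  rw [adj_mulVec_single]
  simp only [Pi.smul_apply, smul_eq_mul]
  by_cases h : γ i j = true
  · have : 0 < deg γ j := Finset.card_pos.2 ⟨i, by simp [h]⟩
    have : (0 : ℝ) < deg γ j := Nat.cast_pos.2 this
    simp [h, this]
  · simp [h]

theorem cubePoints_subset_posSphere {q : ℕ} (N : Seminorm ℝ (Fin q → ℝ))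
    (hN : ∀ x, N x = 0 → x = 0) : cubePoints N ⊆ posSphere N := by
  rintro _ ⟨x, hx, hx0, rfl⟩
  have hpos : 0 < N x := (apply_nonneg N x).lt_of_ne fun h => hx0 (hN x h.symm)
  refine ⟨fun i => mul_nonneg (inv_nonneg.2 hpos.le) ?_, ?_⟩
  · rcases hx i with h | h <;> simp [h]
  · rw [map_smul_eq_mul, norm_inv, Real.norm_of_nonneg hpos.le, inv_mul_cancel₀ hpos.ne']

theorem encard_cubePoints_le {q : ℕ} (N : Seminorm ℝ (Fin q → ℝ)) :
    (cubePoints N).encard ≤ ((2 ^ q - 1 : ℕ) : ℕ∞) := by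
  classical
  set φ : (Fin q → Bool) → Fin q → ℝ := fun c i => if c i = true then 1 else 0
  set s : Finset (Fin q → Bool) := Finset.univ.erase fun _ => false
  have hsub : cubePoints N ⊆ (fun c => (N (φ c))⁻¹ • φ c) '' (s : Set (Fin q → Bool)) := by
    rintro _ ⟨x, hx, hx0, rfl⟩
    have hφ : φ (fun i => decide (x i = 1)) = x := by
      ext i
      rcases hx i with h | h <;> simp [φ, h]
    refine ⟨fun i => decide (x i = 1), ?_, by simp only [hφ]⟩
    simp only [s, Finset.coe_erase, Set.mem_sdiff, Finset.coe_univ, Set.mem_univ, true_and,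
      Set.mem_singleton_iff]
    intro h
    refine hx0 (hφ.symm.trans ?_)
    rw [h]
    ext i
    simp [φ]
  refine (Set.encard_le_encard hsub).trans ((Set.encard_image_le _ _).trans ?_)
  rw [Set.encard_coe_eq_coe_finsetCard, Finset.card_erase_of_mem (Finset.mem_univ _)]
  simp

theorem finite_cubePoints {q : ℕ} (N : Seminorm ℝ (Fin q → ℝ)) : (cubePoints N).Finite :=
  Set.encard_lt_top_iff.1 ((encard_cubePoints_le N).trans_lt (ENat.natCast_lt_top _))

/-- A nonzero column, once normalised, is a point of the cube: the factor `1 / deg j` cancels. -/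
theorem normalize_column_mem_cubePoints {q d : ℕ} (N : Seminorm ℝ (Fin q → ℝ))
    (γ : Fin q → Fin d → Bool) {j : Fin d} (h : N (adj γ *ᵥ Pi.single j 1) ≠ 0) :
    (N (adj γ *ᵥ Pi.single j 1))⁻¹ • (adj γ *ᵥ Pi.single j 1) ∈ cubePoints N := by
  rw [adj_mulVec_single] at h ⊢
  set x : Fin q → ℝ := fun i => if γ i j = true then (1 : ℝ) else 0
  rw [map_smul_eq_mul, norm_inv, Real.norm_natCast] at h ⊢
  have hd : (deg γ j : ℝ) ≠ 0 := fun h0 => by simp [h0] at h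
  refine ⟨x, fun i => ?_, fun h0 => ?_, ?_⟩
  · by_cases hi : γ i j = true <;> simp [x, hi]
  · simp [h0] at h
  · rw [smul_smul, mul_inv, inv_inv, mul_comm (deg γ j : ℝ), mul_assoc, mul_inv_cancel₀ hd, mul_one]

/-- A column whose support is that of the cube point `b` equals the normalised indicator. -/
theorem column_eq_of_support_eq {q d : ℕ} {b : Fin q → ℝ}
    (hb : ∀ i, 0 ≤ b i) {γ : Fin q → Fin d → Bool} {j : Fin d}
    (h : ∀ i, γ i j = decide (0 < b i)) :
    adj γ *ᵥ Pi.single j 1 =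
      (hammingNorm b : ℝ)⁻¹ • fun i => if 0 < b i then (1 : ℝ) else 0 := by
  have hdeg : deg γ j = hammingNorm b := by
    unfold deg hammingNorm
    congr 1
    ext i
    simp [h i, (hb i).lt_iff_ne']
  rw [adj_mulVec_single, hdeg]
  simp [h]

/-- The direction of a column is the cube point `b` exactly if the agents linked to the object are
those in the support of `b`. -/
theorem normalize_column_eq_iff {q d : ℕ} (N : Seminorm ℝ (Fin q → ℝ))
    (hN : ∀ x, N x = 0 → x = 0) {b : Fin q → ℝ} (hb : b ∈ cubePoints N)
    (γ : Fin q → Fin d → Bool) (j : Fin d) :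
    (N (adj γ *ᵥ Pi.single j 1))⁻¹ • (adj γ *ᵥ Pi.single j 1) = b ↔
      ∀ i, γ i j = decide (0 < b i) := by
  have hbS := cubePoints_subset_posSphere N hN hb
  constructor
  · intro h i
    have hpos : 0 < (N (adj γ *ᵥ Pi.single j 1))⁻¹ := by
      refine inv_pos.2 ((apply_nonneg N _).lt_of_ne fun h0 => ?_)
      have h1 := hbS.2
      rw [← h, ← h0] at h1
      simp at h1
    have h2 : 0 < b i ↔ γ i j = true := by
      rw [← adj_mulVec_single_pos_iff γ i j, ← h]
      simp only [Pi.smul_apply, smul_eq_mul]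
      exact mul_pos_iff_of_pos_left hpos
    rw [Bool.eq_iff_iff, decide_eq_true_iff]
    exact h2.symm
  · intro h
    obtain ⟨x, hx, hx0, hbx⟩ := hb
    have hNx : 0 < N x := (apply_nonneg N x).lt_of_ne fun h => hx0 (hN x h.symm)
    have hind : (fun i => if 0 < b i then (1 : ℝ) else 0) = x := by
      ext i
      rcases hx i with hi | hi <;> simp [hbx, hi, hNx]
    have hb0 : b ≠ 0 := fun h0 => by
      have := hbS.2
      simp [h0] at this
    have hh : (0 : ℝ) < hammingNorm b := Nat.cast_pos.2 (hammingNorm_pos_iff.2 hb0)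
    rw [column_eq_of_support_eq hbS.1 h, hind, map_smul_eq_mul, norm_inv,
      Real.norm_natCast, smul_smul, mul_inv, inv_inv, mul_right_comm, mul_inv_cancel₀ hh.ne',
      one_mul, hbx]

theorem measurable_column {Ω : Type*} [MeasurableSpace Ω] {q d : ℕ}
    {G : Ω → Fin q → Fin d → Bool} (hG : Measurable G) (j : Fin d) :
    Measurable fun ω => adj (G ω) *ᵥ Pi.single j 1 :=
  (measurable_of_finite fun γ : Fin q → Fin d → Bool => adj γ *ᵥ Pi.single j (1 : ℝ)).comp hG

theorem integrable_comp_graph {Ω : Type*} [MeasurableSpace Ω] {P : Measure Ω} [IsFiniteMeasure P]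
    {q d : ℕ} {G : Ω → Fin q → Fin d → Bool} (hG : Measurable G)
    (h : (Fin q → Fin d → Bool) → ℝ) : Integrable (fun ω => h (G ω)) P := by
  have : Integrable h (P.map G) := Integrable.of_finite
  exact this.comp_measurable hG

theorem CSInd_pos {Ω : Type*} [MeasurableSpace Ω] {P : Measure Ω} [IsFiniteMeasure P]
    {q d : ℕ} {N : Seminorm ℝ (Fin q → ℝ)} (hN : ∀ x, N x = 0 → x = 0)
    {G : Ω → Fin q → Fin d → Bool} (hG : Measurable G)
    (hedge : ∃ i j, 0 < P.real {ω | G ω i j = true})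
    {K : Fin d → ℝ} (hK : ∀ j, 0 < K j) (α : ℝ) : 0 < CSInd P N G K α := by
  obtain ⟨i, j, hij⟩ := hedge
  have hnn : ∀ j ω, 0 ≤ N (adj (G ω) *ᵥ Pi.single j 1) ^ α := fun j ω =>
    Real.rpow_nonneg (apply_nonneg N _) _
  refine Finset.sum_pos' (fun j _ => mul_nonneg (hK j).le (integral_nonneg (hnn j)))
    ⟨j, Finset.mem_univ j, mul_pos (hK j) ?_⟩
  rw [integral_pos_iff_support_of_nonneg (hnn j)
    (integrable_comp_graph hG fun γ => N (adj γ *ᵥ Pi.single j 1) ^ α)]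
  refine lt_of_lt_of_le (ENNReal.toReal_pos_iff.1 hij).1 (measure_mono fun ω hω => ?_)
  have hpos := (adj_mulVec_single_pos_iff (G ω) i j).2 hω
  refine (Real.rpow_pos_of_pos ((apply_nonneg N _).lt_of_ne fun h => ?_) α).ne'
  simp [hN _ h.symm] at hpos

/-- The agents linked to object `j` form a prescribed set with the product probability. -/
theorem measureReal_column_eq {Ω : Type*} [MeasurableSpace Ω] {P : Measure Ω}
    [IsProbabilityMeasure P] {q d : ℕ} {G : Ω → Fin q → Fin d → Bool} (hG : Measurable G)
    {p : Fin q → Fin d → ℝ} (hp : ∀ i j, P.real {ω | G ω i j = true} = p i j)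
    (hGind : iIndepFun (fun (e : Fin q × Fin d) (ω : Ω) => G ω e.1 e.2) P)
    {b : Fin q → ℝ} (hb : ∀ i, 0 ≤ b i) (j : Fin d) :
    P.real {ω | ∀ i, G ω i j = decide (0 < b i)} =
      ∏ i, (p i j ^ (if 0 < b i then 1 else 0) * (1 - p i j) ^ (if b i = 0 then 1 else 0)) := by
  have hGij : ∀ i, Measurable fun ω => G ω i j := fun i =>
    (measurable_pi_apply j).comp ((measurable_pi_apply i).comp hG)
  have hind : iIndepFun (fun (i : Fin q) (ω : Ω) => G ω i j) P :=
    hGind.precomp (g := fun i : Fin q => (i, j)) fun i i' h => (Prod.ext_iff.1 h).1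
  have hset : {ω | ∀ i, G ω i j = decide (0 < b i)} =
      ⋂ i ∈ (Finset.univ : Finset (Fin q)), (fun ω => G ω i j) ⁻¹' {decide (0 < b i)} := by
    ext ω; simp
  rw [hset, Measure.real, hind.measure_inter_preimage_eq_mul Finset.univ
    (sets := fun i => {decide (0 < b i)}) fun i _ => measurableSet_singleton _, ENNReal.toReal_prod]
  refine Finset.prod_congr rfl fun i _ => ?_
  rw [← hp i j]
  have hm : MeasurableSet {ω | G ω i j = true} := hGij i (measurableSet_singleton true)
  rcases (hb i).eq_or_lt with h | h
  · rw [← probReal_compl_eq_one_sub hm, ← h]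
    simp only [lt_irrefl, decide_false, if_false, if_true, pow_zero, one_mul, pow_one]
    change P.real _ = _
    congr 1
    ext ω
    simp
  · simp only [h, h.ne', decide_true, if_false, if_true, pow_zero, mul_one, pow_one]
    rfl

/-! ### The spectral measure -/

/-- The limiting angular measure of the exposures, as a measure on `ℝ^q`: the direction of the
`j`-th column of the random adjacency matrix, weighted by `K j` and by the `α`-th power of the norm
of the column, and normalised by the total mass `CSInd`. A vanishing column has weight zero. -/
noncomputable def columnMixture {Ω : Type*} [MeasurableSpace Ω] (P : Measure Ω) {q d : ℕ}
    (N : Seminorm ℝ (Fin q → ℝ)) (G : Ω → Fin q → Fin d → Bool) (K : Fin d → ℝ) (α : ℝ) :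
    Measure (Fin q → ℝ) :=
  ∑ j, ENNReal.ofReal (K j / CSInd P N G K α) •
    (P.withDensity fun ω => ENNReal.ofReal (N (adj (G ω) *ᵥ Pi.single j 1) ^ α)).map
      fun ω => (N (adj (G ω) *ᵥ Pi.single j 1))⁻¹ • (adj (G ω) *ᵥ Pi.single j 1)

/-- The restriction of `columnMixture`, which is carried by the positive unit sphere, to it. -/
noncomputable def exposureSpectralMeasure {Ω : Type*} [MeasurableSpace Ω] (P : Measure Ω) {q d : ℕ}
    (N : Seminorm ℝ (Fin q → ℝ)) (G : Ω → Fin q → Fin d → Bool) (K : Fin d → ℝ) (α : ℝ) :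
    Measure (posSphere N) :=
  (columnMixture P N G K α).comap Subtype.val

section Mixture

variable {Ω : Type*} [MeasurableSpace Ω] {P : Measure Ω} {q d : ℕ} (N : Seminorm ℝ (Fin q → ℝ))
  {G : Ω → Fin q → Fin d → Bool} {K : Fin d → ℝ} {α : ℝ}

theorem measurable_normalize_column (hG : Measurable G) (j : Fin d) :
    Measurable fun ω => (N (adj (G ω) *ᵥ Pi.single j 1))⁻¹ • (adj (G ω) *ᵥ Pi.single j 1) :=
  ((seminorm_continuous N).measurable.comp (measurable_column hG j)).inv.smul
    (measurable_column hG j)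

theorem measurable_column_weight (hG : Measurable G) (j : Fin d) :
    Measurable fun ω => ENNReal.ofReal (N (adj (G ω) *ᵥ Pi.single j 1) ^ α) :=
  (((seminorm_continuous N).measurable.comp (measurable_column hG j)).pow_const α).ennreal_ofReal

theorem columnMixture_apply (hG : Measurable G) {s : Set (Fin q → ℝ)} (hs : MeasurableSet s) :
    columnMixture P N G K α s = ∑ j, ENNReal.ofReal (K j / CSInd P N G K α) *
      ∫⁻ ω in (fun ω => (N (adj (G ω) *ᵥ Pi.single j 1))⁻¹ • (adj (G ω) *ᵥ Pi.single j 1)) ⁻¹' s,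
        ENNReal.ofReal (N (adj (G ω) *ᵥ Pi.single j 1) ^ α) ∂P := by
  rw [columnMixture, Measure.finsetSum_apply]
  refine Finset.sum_congr rfl fun j _ => ?_
  have hm := measurable_normalize_column N hG j
  rw [Measure.smul_apply, Measure.map_apply hm hs, withDensity_apply _ (hm hs), smul_eq_mul]

theorem columnMixture_compl_cubePoints (hα : 0 < α) (hG : Measurable G) :
    columnMixture P N G K α (cubePoints N)ᶜ = 0 := by
  have hs : MeasurableSet (cubePoints N) := (finite_cubePoints N).measurableSet
  rw [columnMixture_apply N hG hs.compl]
  refine Finset.sum_eq_zero fun j _ => ?_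
  rw [setLIntegral_congr_fun (g := fun _ => 0) (measurable_normalize_column N hG j hs.compl)
    fun ω hω => ?_, lintegral_zero, mul_zero]
  have h0 : N (adj (G ω) *ᵥ Pi.single j 1) = 0 :=
    not_not.1 fun h => hω (normalize_column_mem_cubePoints N (G ω) h)
  beta_reduce
  rw [h0, Real.zero_rpow hα.ne', ENNReal.ofReal_zero]

/-- The mass of a cube point: the column of object `j` has direction `b` exactly if the agents
linked to `j` form the support of `b`, and its norm is then determined by `b`. -/
theorem columnMixture_singleton (hN : ∀ x, N x = 0 → x = 0) (hG : Measurable G)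
    {b : Fin q → ℝ} (hb : b ∈ cubePoints N) :
    columnMixture P N G K α {b} = ∑ j, ENNReal.ofReal (K j / CSInd P N G K α) *
      (ENNReal.ofReal (N ((hammingNorm b : ℝ)⁻¹ • fun i => if 0 < b i then (1 : ℝ) else 0) ^ α) *
        P {ω | ∀ i, G ω i j = decide (0 < b i)}) := by
  have hs : MeasurableSet ({b} : Set (Fin q → ℝ)) := measurableSet_singleton b
  rw [columnMixture_apply N hG hs]
  refine Finset.sum_congr rfl fun j _ => ?_
  rw [setLIntegral_congr_fun (g := fun _ => ENNReal.ofReal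
      (N ((hammingNorm b : ℝ)⁻¹ • fun i => if 0 < b i then (1 : ℝ) else 0) ^ α))
    (measurable_normalize_column N hG j hs) fun ω hω => ?_, setLIntegral_const]
  · congr 3
    ext ω
    exact normalize_column_eq_iff N hN hb (G ω) j
  · simp only
    rw [column_eq_of_support_eq (cubePoints_subset_posSphere N hN hb).1
      ((normalize_column_eq_iff N hN hb (G ω) j).1 hω)]

variable [IsFiniteMeasure P]

theorem isFiniteMeasure_columnMixture (hG : Measurable G) :
    IsFiniteMeasure (columnMixture P N G K α) := by
  refine ⟨?_⟩
  rw [columnMixture_apply N hG MeasurableSet.univ]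
  refine ENNReal.sum_lt_top.2 fun j _ => ENNReal.mul_lt_top ENNReal.ofReal_lt_top ?_
  simp only [Set.preimage_univ, Measure.restrict_univ]
  exact (integrable_comp_graph hG fun γ =>
    N (adj γ *ᵥ Pi.single j 1) ^ α).lintegral_lt_top

theorem integral_columnMixture (hG : Measurable G) (hC : 0 < CSInd P N G K α)
    (hK : ∀ j, 0 < K j) {g : (Fin q → ℝ) → ℝ} (hg : Continuous g) {M : ℝ} (hM : ∀ x, |g x| ≤ M) :
    ∫ x, g x ∂(columnMixture P N G K α) = (CSInd P N G K α)⁻¹ *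
      ∑ j, K j * ∫ ω, N (adj (G ω) *ᵥ Pi.single j 1) ^ α *
        g ((N (adj (G ω) *ᵥ Pi.single j 1))⁻¹ • (adj (G ω) *ᵥ Pi.single j 1)) ∂P := by
  have hfin := isFiniteMeasure_columnMixture (P := P) N (K := K) (α := α) hG
  have hint : Integrable g (columnMixture P N G K α) :=
    Integrable.of_bound hg.aestronglyMeasurable M (Eventually.of_forall hM)
  rw [columnMixture] at hint ⊢
  rw [integrable_finsetSum_measure] at hint
  rw [integral_finsetSum_measure hint, Finset.mul_sum]
  refine Finset.sum_congr rfl fun j _ => ?_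
  rw [integral_smul_measure, integral_map (measurable_normalize_column N hG j).aemeasurable
      hg.aestronglyMeasurable,
    integral_withDensity_eq_integral_toReal_smul (measurable_column_weight N hG j)
      (Eventually.of_forall fun ω => ENNReal.ofReal_lt_top),
    ENNReal.toReal_ofReal (div_nonneg (hK j).le hC.le), smul_eq_mul, div_eq_inv_mul, mul_assoc]
  congr 2
  refine integral_congr_ae (Eventually.of_forall fun ω => ?_)
  simp only [smul_eq_mul]
  rw [ENNReal.toReal_ofReal (Real.rpow_nonneg (apply_nonneg N _) _)]

theorem integral_exposureSpectralMeasure (hN : ∀ x, N x = 0 → x = 0) (hα : 0 < α)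
    (hG : Measurable G) (hC : 0 < CSInd P N G K α)
    (hK : ∀ j, 0 < K j) {g : (Fin q → ℝ) → ℝ} (hg : Continuous g) {M : ℝ} (hM : ∀ x, |g x| ≤ M) :
    ∫ x, g x.1 ∂(exposureSpectralMeasure P N G K α) = (CSInd P N G K α)⁻¹ *
      ∑ j, K j * ∫ ω, N (adj (G ω) *ᵥ Pi.single j 1) ^ α *
        g ((N (adj (G ω) *ᵥ Pi.single j 1))⁻¹ • (adj (G ω) *ᵥ Pi.single j 1)) ∂P := by
  rw [← integral_columnMixture N hG hC hK hg hM, exposureSpectralMeasure]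
  refine (integral_subtype_comap (isClosed_posSphere N).measurableSet g).trans ?_
  rw [Measure.restrict_eq_self_of_ae_mem]
  exact mem_of_superset (compl_mem_ae_iff.2 (columnMixture_compl_cubePoints N hα hG))
    (by rw [compl_compl]; exact cubePoints_subset_posSphere N hN)

theorem isProbabilityMeasure_exposureSpectralMeasure (hN : ∀ x, N x = 0 → x = 0) (hα : 0 < α)
    (hG : Measurable G) (hC : 0 < CSInd P N G K α) (hK : ∀ j, 0 < K j) :
    IsProbabilityMeasure (exposureSpectralMeasure P N G K α) := by
  have h := integral_exposureSpectralMeasure N hN hα hG hC hK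
    (g := fun _ => 1) continuous_const (M := 1) (by simp)
  simp only [integral_const, smul_eq_mul, mul_one] at h
  rw [show ∑ j, K j * ∫ ω, N (adj (G ω) *ᵥ Pi.single j 1) ^ α ∂P = CSInd P N G K α from rfl,
    inv_mul_cancel₀ hC.ne'] at h
  exact ⟨(ENNReal.toReal_eq_one_iff _).1 h⟩

end Mixture

/-! ### Convergence and uniqueness -/

theorem integral_angularLaw {Ω : Type*} [MeasurableSpace Ω] {P : Measure Ω} {q : ℕ}
    (N : Seminorm ℝ (Fin q → ℝ)) {X : Ω → Fin q → ℝ} (hX : Measurable X)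
    (hX0 : ∀ᵐ ω ∂P, ∀ i, 0 ≤ X ω i) {s : ℝ} (hs : 0 ≤ s) {g : (Fin q → ℝ) → ℝ}
    (hg : Continuous g) :
    ∫ x, g x.1 ∂(angularLaw P N X s) = ∫ ω, angularTest N g s (X ω) ∂P := by
  have hNX : Measurable fun ω => N (X ω) := (seminorm_continuous N).measurable.comp hX
  have hm : Measurable fun ω => (N (X ω))⁻¹ • X ω := hNX.inv.smul hX
  have hset : MeasurableSet {ω | s < N (X ω)} := measurableSet_lt measurable_const hNX
  have hS := (isClosed_posSphere N).measurableSet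
  rw [angularLaw]
  refine (integral_subtype_comap hS g).trans ?_
  rw [Measure.restrict_eq_self_of_ae_mem,
    integral_map hm.aemeasurable hg.aestronglyMeasurable, ← integral_indicator hset]
  · congr 1
  · refine (ae_map_iff hm.aemeasurable hS).2 ?_
    rw [ae_restrict_iff' hset]
    filter_upwards [hX0] with ω hω hlt
    have hpos : 0 < N (X ω) := hs.trans_lt hlt
    refine ⟨fun i => mul_nonneg (inv_nonneg.2 hpos.le) (hω i), ?_⟩
    rw [map_smul_eq_mul, norm_inv, Real.norm_of_nonneg hpos.le, inv_mul_cancel₀ hpos.ne']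

theorem measurable_exposure {Ω : Type*} [MeasurableSpace Ω] {q d : ℕ}
    {G : Ω → Fin q → Fin d → Bool} (hG : Measurable G) {V : Ω → Fin d → ℝ} (hV : Measurable V) :
    Measurable fun ω => adj (G ω) *ᵥ V ω := by
  refine measurable_pi_lambda _ fun i => ?_
  change Measurable fun ω => ∑ j, adj (G ω) i j * V ω j
  refine Finset.measurable_sum _ fun j _ => ?_
  exact ((measurable_of_finite fun γ : Fin q → Fin d → Bool => adj γ i j).comp hG).mul
    ((measurable_pi_apply j).comp hV)

/-- Spectral measures are unique. -/
theorem IsSpectralMeasure.eq {Ω : Type*} [MeasurableSpace Ω] {P : Measure Ω} {q : ℕ}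
    {N : Seminorm ℝ (Fin q → ℝ)} (hN : ∀ x, N x = 0 → x = 0) {X : Ω → Fin q → ℝ} {α : ℝ}
    {ρ ρ' : Measure (posSphere N)} (h : IsSpectralMeasure P N X α ρ)
    (h' : IsSpectralMeasure P N X α ρ') : ρ = ρ' := by
  have := h.isProbabilityMeasure
  have := h'.isProbabilityMeasure
  have : CompactSpace (posSphere N) := isCompact_iff_compactSpace.1 (isCompact_posSphere N hN)
  refine ext_of_forall_integral_eq_of_IsFiniteMeasure fun f => ?_
  have h1 := tendsto_nhds_unique
    (h.vague 1 one_pos f f.continuous (HasCompactSupport.of_compactSpace f))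
    (h'.vague 1 one_pos f f.continuous (HasCompactSupport.of_compactSpace f))
  simpa using h1

/-- A criterion for a spectral measure: it suffices that `t ^ α` times the unnormalised angular laws
beyond the level `t` converge to a positive multiple of `ρ`, when tested on bounded continuous
functions on the whole of `ℝ^q`. -/
theorem isSpectralMeasure_of_tendsto {Ω : Type*} [MeasurableSpace Ω] {P : Measure Ω} {q : ℕ}
    {N : Seminorm ℝ (Fin q → ℝ)} (hN : ∀ x, N x = 0 → x = 0) {X : Ω → Fin q → ℝ}
    (hX : Measurable X) (hX0 : ∀ᵐ ω ∂P, ∀ i, 0 ≤ X ω i) {α : ℝ} (hα : 0 < α)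
    {ρ : Measure (posSphere N)} [IsProbabilityMeasure ρ] {c : ℝ} (hc : 0 < c)
    (h : ∀ (g : (Fin q → ℝ) → ℝ) (M : ℝ), Continuous g → (∀ x, |g x| ≤ M) →
      Tendsto (fun t : ℝ => t ^ α * ∫ ω, angularTest N g t (X ω) ∂P) atTop
        (𝓝 (c * ∫ x, g x.1 ∂ρ))) :
    IsSpectralMeasure P N X α ρ := by
  refine ⟨hα, inferInstance, fun u hu f hf _ => ?_⟩
  have hcpt : CompactSpace (posSphere N) := isCompact_iff_compactSpace.1 (isCompact_posSphere N hN)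
  -- extend the test function from the sphere to a bounded continuous function on `ℝ^q`
  obtain ⟨g, -, hgf⟩ := BoundedContinuousFunction.exists_extension_norm_eq_of_isClosedEmbedding
    (BoundedContinuousFunction.mkOfCompact ⟨f, hf⟩)
    (isClosed_posSphere N).isClosedEmbedding_subtypeVal
  have hfg : f = fun x => g x.1 := by
    ext x
    exact (congrFun hgf x).symm
  have hlim := (h g ‖g‖ g.continuous fun x => g.norm_coe_le_norm x).comp
    (tendsto_id.atTop_mul_const hu)
  have hden := h (fun _ => 1) 1 continuous_const (by simp)
  simp only [integral_const, probReal_univ, smul_eq_mul, mul_one] at hden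
  have hquot := (hlim.div hden hc.ne').const_mul (u ^ (-α))
  have hNX : Measurable fun ω => N (X ω) := (seminorm_continuous N).measurable.comp hX
  rw [integral_smul_measure, ENNReal.toReal_ofReal (Real.rpow_nonneg hu.le _), hfg, smul_eq_mul]
  rw [mul_div_cancel_left₀ _ hc.ne'] at hquot
  refine hquot.congr' ?_
  filter_upwards [eventually_gt_atTop 0] with t ht
  rw [integral_smul_measure, integral_angularLaw N hX hX0 (by positivity) g.continuous,
    ENNReal.toReal_inv, smul_eq_mul]
  have h1 : ∫ ω, angularTest N (fun _ => 1) t (X ω) ∂P = (P {ω | t < N (X ω)}).toReal :=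
    integral_ite_one (measurableSet_lt measurable_const hNX)
  have ht' := (Real.rpow_pos_of_pos ht α).ne'
  have hu' := (Real.rpow_pos_of_pos hu α).ne'
  simp only [Function.comp_apply, id, Pi.div_apply]
  rw [h1, Real.mul_rpow ht.le hu.le, Real.rpow_neg hu.le, mul_comm (t ^ α) (u ^ α), mul_assoc,
    mul_div_assoc, inv_mul_cancel_left₀ hu', mul_div_mul_left _ _ ht', div_eq_inv_mul]

theorem isSpectralMeasure_exposureSpectralMeasure {Ω : Type*} [MeasurableSpace Ω]
    {P : Measure Ω} [IsProbabilityMeasure P] {q d : ℕ}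
    {N : Seminorm ℝ (Fin q → ℝ)} (hN : ∀ x, N x = 0 → x = 0)
    {G : Ω → Fin q → Fin d → Bool} (hG : Measurable G)
    {α : ℝ} (hα : 0 < α) {K : Fin d → ℝ} (hK : ∀ j, 0 < K j)
    {V : Ω → Fin d → ℝ} (hV : Measurable V) (hV0 : ∀ j, ∀ᵐ ω ∂P, 0 ≤ V ω j)
    (hPareto : ∀ j, (fun t : ℝ => P.real {ω | t < V ω j}) ~[atTop] fun t => K j * t ^ (-α))
    (hVind : AsymptoticallyIndependent P V α) (hGV : IndepFun G V P)
    (hC : 0 < CSInd P N G K α) :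
    IsSpectralMeasure P N (fun ω => adj (G ω) *ᵥ V ω) α (exposureSpectralMeasure P N G K α) := by
  have hprob := isProbabilityMeasure_exposureSpectralMeasure N hN hα hG hC hK
  have hF0 : ∀ᵐ ω ∂P, ∀ i, 0 ≤ (adj (G ω) *ᵥ V ω) i :=
    (ae_all_iff.2 hV0).mono fun ω hω => adj_mulVec_nonneg (G ω) hω
  refine isSpectralMeasure_of_tendsto hN (measurable_exposure hG hV) hF0 hα hC
    fun g M hg hM => ?_
  rw [integral_exposureSpectralMeasure N hN hα hG hC hK hg hM, mul_inv_cancel_left₀ hC.ne']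
  exact tendsto_integral_angularTest_exposure N hN hg hM hα hV hV0 hPareto hVind hG hGV

end InsuranceNetwork

theorem corollary3p3 {Ω : Type*} [MeasurableSpace Ω] (P : Measure Ω) [IsProbabilityMeasure P]
    (q d : ℕ)
    -- a norm on `ℝ^q` under which all canonical unit vectors have norm 1
    (N : Seminorm ℝ (Fin q → ℝ)) (hN : ∀ x, N x = 0 → x = 0)
    (hN1 : ∀ i, N (Pi.single i 1) = 1)
    -- the random bipartite graph: independent edges with probabilities `p i j`, not all zero
    (G : Ω → Fin q → Fin d → Bool) (hG : Measurable G)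
    (p : Fin q → Fin d → ℝ) (hp : ∀ i j, P.real {ω | G ω i j = true} = p i j)
    (hGind : iIndepFun (fun (e : Fin q × Fin d) (ω : Ω) => G ω e.1 e.2) P)
    (hp0 : ∃ i j, 0 < p i j)
    -- the claims: Pareto tails, asymptotically independent, independent of the graph
    (α : ℝ) (hα : 0 < α) (K : Fin d → ℝ) (hK : ∀ j, 0 < K j)
    (V : Ω → Fin d → ℝ) (hV : Measurable V) (hV0 : ∀ j, ∀ᵐ ω ∂P, 0 ≤ V ω j)
    (hPareto : ∀ j, (fun t : ℝ => P.real {ω | t < V ω j}) ~[atTop] fun t => K j * t ^ (-α))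
    (hVind : AsymptoticallyIndependent P V α)
    (hGV : IndepFun G V P) :
    -- the exposure vector `F = A V` has a spectral measure
    (∃ ρ : Measure (posSphere N),
      IsSpectralMeasure P N (fun ω => adj (G ω) *ᵥ V ω) α ρ) ∧
    (cubePoints N).encard ≤ ((2 ^ q - 1 : ℕ) : ℕ∞) ∧
    ∀ ρ : Measure (posSphere N),
      IsSpectralMeasure P N (fun ω => adj (G ω) *ᵥ V ω) α ρ →
        (∀ b ∈ ρ.support, (b : Fin q → ℝ) ∈ cubePoints N) ∧
        ρ {b | (b : Fin q → ℝ) ∉ cubePoints N} = 0 ∧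
        ∀ b : posSphere N, (b : Fin q → ℝ) ∈ cubePoints N →
          ρ.real {b} = (CSInd P N G K α)⁻¹
            * N ((hammingNorm (b : Fin q → ℝ) : ℝ)⁻¹ •
                (fun i => if 0 < (b : Fin q → ℝ) i then (1 : ℝ) else 0)) ^ α
            * ∑ j, K j * ∏ i, (p i j ^ (if 0 < (b : Fin q → ℝ) i then 1 else 0)
                * (1 - p i j) ^ (if (b : Fin q → ℝ) i = 0 then 1 else 0)) := by
  have hC : 0 < CSInd P N G K α := CSInd_pos hN hG (by simpa only [hp] using hp0) hK α
  have hspec := isSpectralMeasure_exposureSpectralMeasure hN hG hα hK hV hV0 hPareto hVind hGV hC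
  refine ⟨⟨_, hspec⟩, encard_cubePoints_le N, fun ρ hρ => ?_⟩
  -- by uniqueness, only the explicit spectral measure has to be examined
  obtain rfl := hρ.eq hN hspec
  have hemb : MeasurableEmbedding (Subtype.val : posSphere N → Fin q → ℝ) :=
    MeasurableEmbedding.subtype_coe (isClosed_posSphere N).measurableSet
  have hzero : exposureSpectralMeasure P N G K α
      {b | (b : Fin q → ℝ) ∉ cubePoints N} = 0 := by
    rw [exposureSpectralMeasure, hemb.comap_apply]
    refine measure_mono_null ?_ (columnMixture_compl_cubePoints (P := P) N (K := K) hα hG)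
    rintro _ ⟨b, hb, rfl⟩
    exact hb
  refine ⟨fun b hb => ?_, hzero, fun b hb => ?_⟩
  · exact Measure.support_subset_of_isClosed
      ((finite_cubePoints N).isClosed.preimage continuous_subtype_val)
      (mem_ae_iff.2 hzero) hb
  · have hb0 : ∀ i, 0 ≤ (b : Fin q → ℝ) i := b.2.1
    rw [Measure.real, exposureSpectralMeasure, hemb.comap_apply, Set.image_singleton,
      columnMixture_singleton N hN hG hb, ENNReal.toReal_sum fun j _ => ENNReal.mul_ne_top
        ENNReal.ofReal_ne_top (ENNReal.mul_ne_top ENNReal.ofReal_ne_top (measure_ne_top _ _)),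
      Finset.mul_sum]
    refine Finset.sum_congr rfl fun j _ => ?_
    rw [← measureReal_column_eq hG hp hGind hb0 j, ENNReal.toReal_mul, ENNReal.toReal_mul,
      ENNReal.toReal_ofReal (div_nonneg (hK j).le hC.le),
      ENNReal.toReal_ofReal (Real.rpow_nonneg (apply_nonneg N _) _), Measure.real]
    ring
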